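/- Let $\mathsf H_1\subseteq \mathsf H_0$ be complex Hilbert spaces with continuous embedding. Let $A$ be a self-adjoint operator in $\mathsf H_1$ that has a self-adjoint extension in $\mathsf H_0$, also denoted $A$, whose domain contains $\mathsf H_1$. Let $\Phi^A(t)=e^{-itA}$ be the strongly continuous unitary group on $\mathsf H_1$ generated by $-iA$, and let $E$ be the projection-valued spectral measure of the operator $A$ in $\mathsf H_0$. Let $B:\mathsf H_1\to\mathsf H_1$ be locally Lipschitz, and assume that there is a map $B'$ from $\mathsf H_1$ to the bounded (real-)linear operators on $\mathsf H_0$ such that for all $r,\varepsilon>0$ there are $C,\delta>0$ with $$\|B'(u)\|\le C,\qquad \|B(u+w)-B(u)-B'(u)w\|_{\mathsf H_0}\le \varepsilon\|w\|_{\mathsf H_0}$$ whenever $u,w\in \mathsf H_1$, $\|u\|_{\mathsf H_1}\le r$, $\|w\|_{\mathsf H_1}<\delta$. For $u_0\in\mathsf H_1$ let $\Phi(t)u_0=u(t)$, $0\le t<T^*(u_0)$, be the maximal solution in $C([0,T^*(u_0)),\mathsf H_1)$ of $$u(t)=\Phi^A(t)u_0-i\int_0^t\Phi^A(t-s)B(u(s))\,ds,$$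 and let $\Phi^B(t)$, $t\in\mathbb R$, be the (local) flow of $w_t=-iB(w)$ in $\mathsf H_1$. Let $a_1,\dots,a_m,b_1,\dots,b_m\in\mathbb R$ with $\sum_j a_j=\sum_j b_j=1$. For $h>0$ and $R>0$ put $P=E([-R,R])$ and $$\widetilde\Phi_{h}=\Phi^B(b_mh)\circ\Phi^A(a_mh)\circ P\circ\cdots\circ\Phi^B(b_1h)\circ\Phi^A(a_1h)\circ P .$$ **Theorem (Spectral approximation).** Let $u_0\in\mathsf H_1$ and $0<T<T^*(u_0)$, and write $h_n=T/n$, $\widetilde\Phi_n=\widetilde\Phi_{h_n}$. There exist $C>0$ and $n_0\in\mathbb N$, $n_0\geq 1$, such that for every $n\ge n_0$ and every $R>h_n^{-2}$ the iterates $\widetilde\Phi_n^k u_0$, $0\le k\le n$, are well defined in $\mathsf H_1$ (in particular $P$ maps the vectors to which it is applied into $\mathsf H_1$) and $$\max_{0\le k\le n}\big\|\Phi(kh_n)u_0-\widetilde\Phi_n^k u_0\big\|_{\mathsf H_0}\le C\,h_n .$$ -/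

import Mathlib

open scoped InnerProductSpace ENNReal

/-- A projection-valued measure on the Borel sets of `ℝ`, acting on a complex Hilbert space `H`. -/
structure ProjectionValuedMeasure (H : Type*) [NormedAddCommGroup H] [InnerProductSpace ℂ H]
    [CompleteSpace H] where
  /-- The projection attached to a set (meaningful for Borel sets only). -/
  proj : Set ℝ → H →L[ℂ] H
  isStarProjection : ∀ S, MeasurableSet S → IsStarProjection (proj S)
  univ_eq_one : proj Set.univ = 1
  inter_eq_mul : ∀ S S', MeasurableSet S → MeasurableSet S' →
    proj (S ∩ S') = proj S * proj S'
  hasSum_iUnion : ∀ f : ℕ → Set ℝ, (∀ i, MeasurableSet (f i)) →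
    Pairwise (Function.onFun Disjoint f) →
    ∀ x : H, HasSum (fun i => proj (f i) x) (proj (⋃ i, f i) x)

namespace ProjectionValuedMeasure

variable {H : Type*} [NormedAddCommGroup H] [InnerProductSpace ℂ H] [CompleteSpace H]

theorem inner_proj_self (E : ProjectionValuedMeasure H) {S : Set ℝ} (hS : MeasurableSet S)
    (x : H) : ⟪x, E.proj S x⟫_ℂ = ((‖E.proj S x‖ ^ 2 : ℝ) : ℂ) := by
  have h := E.isStarProjection S hS
  have h1 : E.proj S (E.proj S x) = E.proj S x :=
    congrArg (fun T : H →L[ℂ] H => T x) h.isIdempotentElem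
  have h2 : (E.proj S).adjoint = E.proj S := h.isSelfAdjoint
  calc ⟪x, E.proj S x⟫_ℂ = ⟪x, E.proj S (E.proj S x)⟫_ℂ := by rw [h1]
    _ = ⟪(E.proj S).adjoint x, E.proj S x⟫_ℂ :=
        (ContinuousLinearMap.adjoint_inner_left _ _ _).symm
    _ = ⟪E.proj S x, E.proj S x⟫_ℂ := by rw [h2]
    _ = _ := by rw [inner_self_eq_norm_sq_to_K]; norm_cast

theorem proj_empty (E : ProjectionValuedMeasure H) : E.proj ∅ = 0 := by
  ext x
  have h := E.hasSum_iUnion (fun _ => ∅) (fun _ => MeasurableSet.empty)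
    (fun _ _ _ => by simp [Function.onFun]) x
  have h0 := h.summable.tendsto_atTop_zero
  simpa using tendsto_nhds_unique tendsto_const_nhds h0

theorem hasSum_norm_sq (E : ProjectionValuedMeasure H) (x : H) (f : ℕ → Set ℝ)
    (hf : ∀ i, MeasurableSet (f i)) (hd : Pairwise (Function.onFun Disjoint f)) :
    HasSum (fun i => ‖E.proj (f i) x‖ ^ 2) (‖E.proj (⋃ i, f i) x‖ ^ 2) := by
  have h := (innerSL ℂ x).hasSum (E.hasSum_iUnion f hf hd x)
  simp only [innerSL_apply_apply] at h
  rw [E.inner_proj_self (MeasurableSet.iUnion hf)] at h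
  simp only [fun i => E.inner_proj_self (hf i) x] at h
  exact_mod_cast h

/-- The scalar spectral measure `S ↦ ⟪x, E(S) x⟫ = ‖E(S) x‖²` of the vector `x`. -/
noncomputable def scalarMeasure (E : ProjectionValuedMeasure H) (x : H) :
    MeasureTheory.Measure ℝ :=
  MeasureTheory.Measure.ofMeasurable (fun S _ => ENNReal.ofReal (‖E.proj S x‖ ^ 2))
    (by simp [E.proj_empty])
    (fun f hf hd => by
      have h := E.hasSum_norm_sq x f hf hd
      rw [← h.tsum_eq]
      exact ENNReal.ofReal_tsum_of_nonneg (fun i => sq_nonneg _) h.summable)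

end ProjectionValuedMeasure

/-- `E` is the projection-valued spectral measure of the operator `A`, that is
`A = ∫ λ dE(λ)`: the domain of `A` consists of the vectors `x` with `∫ λ² d⟪x, E(λ)x⟫ < ∞`,
and `⟪x, A x⟫ = ∫ λ d⟪x, E(λ)x⟫` on the domain. -/
structure IsSpectralMeasureOf {H : Type*} [NormedAddCommGroup H] [InnerProductSpace ℂ H]
    [CompleteSpace H] (A : H →ₗ.[ℂ] H) (E : ProjectionValuedMeasure H) : Prop where
  mem_domain_iff : ∀ x : H, x ∈ A.domain ↔
    MeasureTheory.Integrable (fun l : ℝ => l ^ 2) (E.scalarMeasure x)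
  inner_apply : ∀ x : A.domain,
    ⟪(x : H), A x⟫_ℂ = ((∫ l : ℝ, l ∂(E.scalarMeasure (x : H)) : ℝ) : ℂ)

/-- `U` is the strongly continuous one-parameter unitary group with generator `-iA`
(including the exact domain of the generator). -/
structure IsUnitaryGroupGeneratedBy {H : Type*} [NormedAddCommGroup H] [InnerProductSpace ℂ H]
    [CompleteSpace H] (A : H →ₗ.[ℂ] H) (U : ℝ → H →L[ℂ] H) : Prop where
  mem_unitary : ∀ t, U t ∈ unitary (H →L[ℂ] H)
  zero : U 0 = 1
  add : ∀ s t, U (s + t) = U s * U t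
  continuous : ∀ x, Continuous fun t => U t x
  hasDerivAt_iff : ∀ x y : H, HasDerivAt (fun t => U t x) y 0 ↔
    ∃ hx : x ∈ A.domain, y = -(Complex.I • A ⟨x, hx⟩)

section Flows

variable {H : Type*} [NormedAddCommGroup H] [InnerProductSpace ℂ H]

/-- `u ∈ C([0,T], H)` solves the Duhamel equation
`u(t) = Φᴬ(t) u₀ - i ∫₀ᵗ Φᴬ(t - s) B(u(s)) ds` on `[0,T]`. -/
def IsDuhamelSolution (ΦA : ℝ → H →L[ℂ] H) (B : H → H) (u₀ : H) (T : ℝ) (u : ℝ → H) : Prop :=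
  ContinuousOn u (Set.Icc 0 T) ∧
    ∀ t ∈ Set.Icc 0 T, u t = ΦA t u₀ - Complex.I • ∫ s in (0 : ℝ)..t, ΦA (t - s) (B (u s))

/-- The maximal existence time `T*(u₀) ∈ [0, ∞]` of the Duhamel equation. -/
noncomputable def maximalTime (ΦA : ℝ → H →L[ℂ] H) (B : H → H) (u₀ : H) : EReal :=
  sSup {τ : EReal | ∃ T : ℝ, 0 ≤ T ∧ τ = T ∧ ∃ u, IsDuhamelSolution ΦA B u₀ T u}

/-- The exact flow `Φ(t)`, `t ≥ 0`, of `u' = -i(A + B)u` as a partial map: `Φ(t)u₀` is the value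
at time `t` of the solution of the Duhamel equation, defined when a solution on `[0,t]` exists. -/
noncomputable def exactFlow (ΦA : ℝ → H →L[ℂ] H) (B : H → H) (t : ℝ) (u₀ : H) : Part H :=
  ⟨0 ≤ t ∧ ∃ u, IsDuhamelSolution ΦA B u₀ t u, fun h => h.2.choose t⟩

/-- The flow `Φᴮ(t)`, `t ∈ ℝ`, of `w' = -i B(w)` as a partial map: `Φᴮ(t)w₀` is the value at
time `t` of the solution starting at `w₀`, defined when a solution exists on the closed interval
between `0` and `t`. -/
noncomputable def nonlinearFlow (B : H → H) (t : ℝ) (w₀ : H) : Part H :=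
  ⟨∃ w : ℝ → H, w 0 = w₀ ∧
      IsIntegralCurveOn w (fun _ x => -(Complex.I • B x)) (Set.uIcc 0 t),
    fun h => h.choose t⟩

/-- One step of the splitting scheme with coefficients `a`, `b` and step size `h`,
`Φᴮ(b_m h) ∘ Ψ(a_m h) ∘ ⋯ ∘ Φᴮ(b_1 h) ∘ Ψ(a_1 h)`,
as a composition of partial maps; `a 0`, `b 0` stand for `a_1`, `b_1`. -/
noncomputable def splittingStep (ΨA ΦB : ℝ → H → Part H) {m : ℕ} (a b : Fin m → ℝ) (h : ℝ)
    (x : H) : Part H :=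
  (List.finRange m).foldl (fun y j => (y.bind (ΨA (a j * h))).bind (ΦB (b j * h))) (Part.some x)

/-- The `k`-th iterate of a partial map. -/
def partialIterate (F : H → Part H) : ℕ → H → Part H
  | 0, x => Part.some x
  | k + 1, x => (partialIterate F k x).bind F

end Flows

section Embedding

variable {H₁ H₀ : Type*} [NormedAddCommGroup H₁] [InnerProductSpace ℂ H₁]
  [NormedAddCommGroup H₀] [InnerProductSpace ℂ H₀]

/-- The operator `P` of `H₀` regarded as a partial map of the subspace `H₁` (embedded by `ι`):
it is defined at `x ∈ H₁` exactly when `P x` belongs to `H₁`. -/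
noncomputable def restrictToSubspace (ι : H₁ →L[ℂ] H₀) (P : H₀ →L[ℂ] H₀) (x : H₁) : Part H₁ :=
  ⟨∃ y : H₁, ι y = P (ι x), fun h => h.choose⟩

/-- The truncated linear flow `Φᴬ(t) ∘ P` on `H₁`. -/
noncomputable def truncatedFlow (ι : H₁ →L[ℂ] H₀) (P : H₀ →L[ℂ] H₀) (ΦA : ℝ → H₁ →L[ℂ] H₁)
    (t : ℝ) (x : H₁) : Part H₁ :=
  (restrictToSubspace ι P x).map (ΦA t)

end Embedding

/-!
The nonlinearity is Lipschitz with respect to the norm of `H₀` only on a small `H₁`-neighbourhood of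
a compact set, so the iterates have to be controlled in both norms. On the compact trajectory
`u([0, T])` the truncated group is uniformly close to the identity in `H₁` for small times and large
`R`, which makes the scheme consistent in `H₁`, without a rate. By stability this keeps the iterates
in a tube around the trajectory on which `Φᴮ` is defined. There an error of order `h` in the norm of
`H₀` propagates: `H₁ ⊆ dom A₀` and the closed graph theorem give `‖Φᴬ(t)x - x‖ ≤ C|t|‖x‖₁` and
`‖Px - x‖ ≤ (C / R)‖x‖₁ ≤ C h²‖x‖₁`.

The projection `P = E([-R, R])` preserves `H₁` because it is a strong limit of continuous functions
of the bounded operator `(1 + A₀²)⁻¹`, which on `H₁` coincides with `(1 + A²)⁻¹`; as `A` is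
self-adjoint in the Hilbert space `H₁`, the same limit exists there.
-/

open Filter Topology

/-! ### The resolvent `(1 + A²)⁻¹` of a self-adjoint operator -/

/-- `S` is the bounded operator `(1 + A²)⁻¹`, encoded on the graph of `A` so that no domain of `A²`
is needed: `z = A (S y)` and `y - S y = A z`. -/
def IsInvOneAddSq {H : Type*} [NormedAddCommGroup H] [InnerProductSpace ℂ H] (A : H →ₗ.[ℂ] H)
    (S : H →L[ℂ] H) : Prop :=
  ∀ y, ∃ z, (S y, z) ∈ A.graph ∧ (z, y - S y) ∈ A.graph

theorem IsInvOneAddSq.injective {H : Type*} [NormedAddCommGroup H] [InnerProductSpace ℂ H]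
    {A : H →ₗ.[ℂ] H} {S : H →L[ℂ] H} (hS : IsInvOneAddSq A S) : Function.Injective S := by
  refine (injective_iff_map_eq_zero S).2 fun y hy => ?_
  obtain ⟨z, hz, hAz⟩ := hS y
  rw [hy] at hz hAz
  rw [A.mem_graph_snd_inj hz A.graph.zero_mem rfl, sub_zero] at hAz
  exact A.mem_graph_snd_inj hAz A.graph.zero_mem rfl

section SelfAdjoint

variable {H : Type*} [NormedAddCommGroup H] [InnerProductSpace ℂ H] [CompleteSpace H]
  {A : H →ₗ.[ℂ] H}

theorem inner_eq_of_mem_graph (hA : IsSelfAdjoint A) {x y x' y' : H} (h : (x, y) ∈ A.graph)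
    (h' : (x', y') ∈ A.graph) : ⟪y, x'⟫_ℂ = ⟪x, y'⟫_ℂ := by
  have hformal := LinearPMap.adjoint_isFormalAdjoint hA.dense_domain
  rw [LinearPMap.isSelfAdjoint_def.1 hA] at hformal
  rw [LinearPMap.mem_graph_iff] at h h'
  obtain ⟨a, rfl, rfl⟩ := h
  obtain ⟨b, rfl, rfl⟩ := h'
  exact hformal a b

theorem mem_graph_of_forall_inner_eq (hA : IsSelfAdjoint A) {z w : H}
    (h : ∀ x y, (x, y) ∈ A.graph → ⟪w, x⟫_ℂ = ⟪z, y⟫_ℂ) : (z, w) ∈ A.graph := by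
  have h' : ∀ x : A.domain, ⟪w, (x : H)⟫_ℂ = ⟪z, A x⟫_ℂ := fun x => h _ _ (A.mem_graph x)
  have hz : z ∈ A.adjoint.domain := LinearPMap.mem_adjoint_domain_of_exists z ⟨w, h'⟩
  have hw := LinearPMap.adjoint_apply_eq hA.dense_domain ⟨z, hz⟩ h'
  have hmem : (z, w) ∈ A.adjoint.graph := hw ▸ A.adjoint.mem_graph ⟨z, hz⟩
  rwa [LinearPMap.isSelfAdjoint_def.1 hA] at hmem

/-- The first component of the orthogonal projection of `(y, 0)` onto the graph of `A` is
`(1 + A²)⁻¹ y`. -/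
theorem exists_isInvOneAddSq (hA : IsSelfAdjoint A) : ∃ S, IsInvOneAddSq A S := by
  let e := WithLp.prodContinuousLinearEquiv 2 ℂ H H
  let G : Submodule ℂ (WithLp 2 (H × H)) :=
    A.graph.comap (e.toLinearEquiv : WithLp 2 (H × H) →ₗ[ℂ] H × H)
  have hG : IsClosed (G : Set (WithLp 2 (H × H))) :=
    IsClosed.preimage e.continuous hA.isClosed
  have : CompleteSpace G := hG.completeSpace_coe
  let inl : H →L[ℂ] WithLp 2 (H × H) :=
    (e.symm : (H × H) →L[ℂ] WithLp 2 (H × H)).comp (ContinuousLinearMap.inl ℂ H H)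
  refine ⟨(ContinuousLinearMap.fst ℂ H H).comp
    ((e : WithLp 2 (H × H) →L[ℂ] H × H).comp (G.starProjection.comp inl)), fun y => ?_⟩
  set p := G.starProjection (inl y) with hp
  refine ⟨(e p).2, G.starProjection_apply_mem _, mem_graph_of_forall_inner_eq hA fun a b hab => ?_⟩
  have horth := (Submodule.mem_orthogonal' _ _).1 (G.sub_starProjection_mem_orthogonal (inl y))
    (e.symm (a, b)) (by simpa [G] using hab)
  rw [← hp, WithLp.prod_inner_apply] at horth
  have hsum : ⟪y - (e p).1, a⟫_ℂ + ⟪0 - (e p).2, b⟫_ℂ = 0 := horth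
  rw [zero_sub, inner_neg_left] at hsum
  change ⟪y - (e p).1, a⟫_ℂ = ⟪(e p).2, b⟫_ℂ
  linear_combination hsum

namespace IsInvOneAddSq

variable {S : H →L[ℂ] H}

theorem apply_eq_of_mem_graph (hA : IsSelfAdjoint A) (hS : IsInvOneAddSq A S) {x y z : H}
    (hx : (x, z) ∈ A.graph) (hz : (z, y - x) ∈ A.graph) : S y = x := by
  obtain ⟨w, hSy, hw⟩ := hS y
  have h := inner_eq_of_mem_graph hA (A.graph.sub_mem hSy hx) (A.graph.sub_mem hw hz)
  have hneg : y - S y - (y - x) = -(S y - x) := by abel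
  simp only [hneg, inner_neg_right, inner_self_eq_norm_sq_to_K] at h
  have hsq : ‖w - z‖ ^ 2 = -‖S y - x‖ ^ 2 := by exact_mod_cast h
  have hzero : ‖S y - x‖ ^ 2 = 0 := by nlinarith [sq_nonneg ‖w - z‖, sq_nonneg ‖S y - x‖]
  simpa [sub_eq_zero] using hzero

theorem isSelfAdjoint (hA : IsSelfAdjoint A) (hS : IsInvOneAddSq A S) : IsSelfAdjoint S := by
  rw [ContinuousLinearMap.isSelfAdjoint_iff_isSymmetric]
  intro y y'
  obtain ⟨z, hy, hz⟩ := hS y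
  obtain ⟨z', hy', hz'⟩ := hS y'
  have h := inner_eq_of_mem_graph hA hy hz'
  have h' := inner_eq_of_mem_graph hA hz hy'
  rw [inner_sub_right] at h
  rw [inner_sub_left] at h'
  change ⟪S y, y'⟫_ℂ = ⟪y, S y'⟫_ℂ
  linear_combination -h - h'

end IsInvOneAddSq

theorem re_inner_add_sq_of_mem_graph (hA : IsSelfAdjoint A) {x y z : H}
    (hx : (x, z) ∈ A.graph) (hz : (z, y - x) ∈ A.graph) :
    RCLike.re ⟪x, y⟫_ℂ = ‖x‖ ^ 2 + ‖z‖ ^ 2 := by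
  have h := inner_eq_of_mem_graph hA hx hz
  rw [inner_sub_right, inner_self_eq_norm_sq_to_K, inner_self_eq_norm_sq_to_K] at h
  have hofReal : ⟪x, y⟫_ℂ = ((‖x‖ ^ 2 + ‖z‖ ^ 2 : ℝ) : ℂ) := by
    push_cast
    linear_combination -h
  rw [hofReal, RCLike.re_to_complex, Complex.ofReal_re]

namespace IsInvOneAddSq

variable {S : H →L[ℂ] H}

theorem nonneg (hA : IsSelfAdjoint A) (hS : IsInvOneAddSq A S) : 0 ≤ S := by
  rw [ContinuousLinearMap.nonneg_iff_isPositive, ContinuousLinearMap.isPositive_def']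
  refine ⟨hS.isSelfAdjoint hA, fun y => ?_⟩
  obtain ⟨z, hy, hz⟩ := hS y
  rw [ContinuousLinearMap.reApplyInnerSelf_apply, re_inner_add_sq_of_mem_graph hA hy hz]
  positivity

theorem denseRange (hA : IsSelfAdjoint A) (hS : IsInvOneAddSq A S) : DenseRange S := by
  have hker : (LinearMap.range (S : H →ₗ[ℂ] H))ᗮ = ⊥ := by
    refine (Submodule.eq_bot_iff _).2 fun y hy => hS.injective ?_
    rw [map_zero]
    refine ext_inner_right ℂ fun v => ?_
    rw [inner_zero_left, ← (Submodule.mem_orthogonal' _ _).1 hy (S v) ⟨v, rfl⟩]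
    exact ContinuousLinearMap.isSelfAdjoint_iff_isSymmetric.1 (hS.isSelfAdjoint hA) y v
  exact Submodule.dense_iff_topologicalClosure_eq_top.2
    (Submodule.topologicalClosure_eq_top_iff.2 hker)

end IsInvOneAddSq

end SelfAdjoint

theorem IsInvOneAddSq.comp_eq {H K : Type*} [NormedAddCommGroup H] [InnerProductSpace ℂ H]
    [NormedAddCommGroup K] [InnerProductSpace ℂ K] [CompleteSpace K]
    {A : H →ₗ.[ℂ] H} {S : H →L[ℂ] H} {A' : K →ₗ.[ℂ] K} {S' : K →L[ℂ] K}
    (hS : IsInvOneAddSq A S) (hA' : IsSelfAdjoint A') (hS' : IsInvOneAddSq A' S')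
    {J : H →L[ℂ] K} (hJ : ∀ x y, (x, y) ∈ A.graph → (J x, J y) ∈ A'.graph) :
    J.comp S = S'.comp J := by
  ext y
  obtain ⟨z, hSy, hz⟩ := hS y
  have hJz := hJ _ _ hz
  rw [J.map_sub] at hJz
  exact (hS'.apply_eq_of_mem_graph hA' (hJ _ _ hSy) hJz).symm

/-! ### Functional calculus of bounded self-adjoint operators -/

section Intertwining

variable {H K : Type*} [NormedAddCommGroup H] [InnerProductSpace ℂ H]
  [NormedAddCommGroup K] [InnerProductSpace ℂ K] {X : H →L[ℂ] H} {Y : K →L[ℂ] K} {J : H →L[ℂ] K}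

theorem comp_pow_eq_of_comp_eq (h : J.comp X = Y.comp J) (n : ℕ) :
    J.comp (X ^ n) = (Y ^ n).comp J := by
  induction n with
  | zero => rfl
  | succ n ih =>
    rw [pow_succ, pow_succ]
    change (J.comp (X ^ n)).comp X = (Y ^ n).comp (Y.comp J)
    rw [ih, ← h]
    rfl

open Polynomial in
theorem comp_aeval_eq_of_comp_eq (h : J.comp X = Y.comp J) (p : ℝ[X]) :
    J.comp (aeval X p) = (aeval Y p).comp J := by
  induction p using Polynomial.induction_on' with
  | add p q hp hq =>
    simp only [map_add, ContinuousLinearMap.comp_add, ContinuousLinearMap.add_comp, hp, hq]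
  | monomial n r =>
    rw [aeval_monomial, aeval_monomial, ← Algebra.smul_def, ← Algebra.smul_def]
    ext x
    have hpow := congrArg (fun T => T x) (comp_pow_eq_of_comp_eq h n)
    simp only [ContinuousLinearMap.comp_apply, smul_apply] at hpow ⊢
    rw [J.map_smul_of_tower, hpow]

theorem norm_cfc_sub_aeval_le [CompleteSpace H] (hX : IsSelfAdjoint X) {f : ℝ → ℝ}
    (hf : ContinuousOn f (spectrum ℝ X)) {p : Polynomial ℝ} {ε : ℝ} (hε : 0 ≤ ε)
    (hp : ∀ t ∈ spectrum ℝ X, |p.eval t - f t| ≤ ε) : ‖cfc f X - Polynomial.aeval X p‖ ≤ ε := by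
  rw [← cfc_polynomial (R := ℝ) p X, ← cfc_sub f p.eval X hf]
  refine norm_cfc_le hε fun t ht => ?_
  rw [norm_sub_rev]
  exact hp t ht

theorem comp_cfc_eq_of_comp_eq [CompleteSpace H] [CompleteSpace K] (hX : IsSelfAdjoint X)
    (hY : IsSelfAdjoint Y) (h : J.comp X = Y.comp J) {f : ℝ → ℝ} (hf : Continuous f) :
    J.comp (cfc f X) = (cfc f Y).comp J := by
  refine eq_of_forall_dist_le fun ε hε => ?_
  obtain ⟨M, hM⟩ : ∃ M, ∀ t ∈ spectrum ℝ X ∪ spectrum ℝ Y, |t| ≤ M :=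
    ((ContinuousFunctionalCalculus.isCompact_spectrum (R := ℝ) X).union
      (ContinuousFunctionalCalculus.isCompact_spectrum (R := ℝ) Y)).isBounded.exists_norm_le
  set δ := ε / (2 * (‖J‖ + 1)) with hδ
  have hδ0 : 0 < δ := by positivity
  obtain ⟨p, hp⟩ := exists_polynomial_near_of_continuousOn (-M) M f hf.continuousOn δ hδ0
  have hnear : ∀ t ∈ spectrum ℝ X ∪ spectrum ℝ Y, |p.eval t - f t| ≤ δ := fun t ht =>
    (hp t (abs_le.1 (hM t ht))).le
  have hXp := norm_cfc_sub_aeval_le hX hf.continuousOn hδ0.le fun t ht => hnear t (Or.inl ht)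
  have hYp := norm_cfc_sub_aeval_le hY hf.continuousOn hδ0.le fun t ht => hnear t (Or.inr ht)
  have hsplit : J.comp (cfc f X) - (cfc f Y).comp J =
      J.comp (cfc f X - Polynomial.aeval X p) - (cfc f Y - Polynomial.aeval Y p).comp J := by
    rw [ContinuousLinearMap.comp_sub, ContinuousLinearMap.sub_comp, comp_aeval_eq_of_comp_eq h]
    abel
  rw [dist_eq_norm, hsplit]
  calc _ ≤ ‖J‖ * δ + δ * ‖J‖ :=
        (norm_sub_le _ _).trans (add_le_add
          ((ContinuousLinearMap.opNorm_comp_le _ _).trans (by gcongr))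
          ((ContinuousLinearMap.opNorm_comp_le _ _).trans (by gcongr)))
    _ ≤ 2 * (‖J‖ + 1) * δ := by linarith
    _ = ε := by rw [hδ]; field_simp

end Intertwining

/-- The continuous function decreasing in `n` to the indicator function of `[c, ∞)`. -/
noncomputable def cutoff (c : ℝ) (n : ℕ) (t : ℝ) : ℝ := max 0 (min 1 (1 + (n + 1) * (t - c)))

theorem continuous_cutoff (c : ℝ) (n : ℕ) : Continuous (cutoff c n) := by
  unfold cutoff; fun_prop

theorem cutoff_nonneg (c : ℝ) (n : ℕ) (t : ℝ) : 0 ≤ cutoff c n t := le_max_left _ _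

theorem cutoff_le_one (c : ℝ) (n : ℕ) (t : ℝ) : cutoff c n t ≤ 1 :=
  max_le zero_le_one (min_le_left _ _)

theorem cutoff_eq_one {c t : ℝ} (n : ℕ) (h : c ≤ t) : cutoff c n t = 1 := by
  have hslope : 0 ≤ ((n : ℝ) + 1) * (t - c) := mul_nonneg (by positivity) (by linarith)
  rw [cutoff, min_eq_left (by linarith), max_eq_right zero_le_one]

theorem cutoff_eq_zero {c t : ℝ} {n : ℕ} (h : 1 ≤ ((n : ℝ) + 1) * (c - t)) :
    cutoff c n t = 0 := by
  rw [cutoff, max_eq_left]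
  exact (min_le_right _ _).trans (by nlinarith)

theorem cutoff_antitone (c t : ℝ) : Antitone fun n => cutoff c n t := by
  intro n m h
  have hcast : (n : ℝ) ≤ m := by exact_mod_cast h
  rcases le_total c t with hc | hc
  · simp only [cutoff_eq_one _ hc, le_refl]
  · simp only [cutoff]
    gcongr max 0 (min 1 (1 + ?_))
    nlinarith

theorem exists_tendsto_of_sq_norm_sub_le {E : Type*} [NormedAddCommGroup E] [CompleteSpace E]
    {z : ℕ → E} {a : ℕ → ℝ} (ha : BddBelow (Set.range a))
    (h : ∀ n m, n ≤ m → ‖z m - z n‖ ^ 2 ≤ a n - a m) : ∃ y, Tendsto z atTop (𝓝 y) := by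
  have hanti : Antitone a := fun n m hnm =>
    sub_nonneg.1 ((sq_nonneg ‖z m - z n‖).trans (h n m hnm))
  have hlim := tendsto_atTop_ciInf hanti ha
  refine cauchySeq_tendsto_of_complete (Metric.cauchySeq_iff'.2 fun ε hε => ?_)
  obtain ⟨N, hN⟩ := (hlim.eventually (gt_mem_nhds (lt_add_of_pos_right _ (pow_pos hε 2)))).exists
  refine ⟨N, fun n hn => lt_of_pow_lt_pow_left₀ 2 hε.le ?_⟩
  rw [dist_eq_norm]
  linarith [h N n hn, ciInf_le ha n]

section Cutoff

variable {H : Type*} [NormedAddCommGroup H] [InnerProductSpace ℂ H] [CompleteSpace H]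
  {S : H →L[ℂ] H}

theorem nonneg_iff_re_inner : 0 ≤ S ↔ IsSelfAdjoint S ∧ ∀ x, 0 ≤ RCLike.re ⟪S x, x⟫_ℂ := by
  rw [ContinuousLinearMap.nonneg_iff_isPositive, ContinuousLinearMap.isPositive_def']
  rfl

theorem le_iff_re_inner {T : H →L[ℂ] H} (hS : IsSelfAdjoint S) (hT : IsSelfAdjoint T) :
    S ≤ T ↔ ∀ x, RCLike.re ⟪S x, x⟫_ℂ ≤ RCLike.re ⟪T x, x⟫_ℂ := by
  rw [← sub_nonneg, nonneg_iff_re_inner]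
  simp [hT.sub hS]

theorem sq_norm_cfc_apply_le {f : ℝ → ℝ} (hf : ContinuousOn f (spectrum ℝ S))
    (h0 : ∀ t ∈ spectrum ℝ S, 0 ≤ f t) (h1 : ∀ t ∈ spectrum ℝ S, f t ≤ 1) (x : H) :
    ‖cfc f S x‖ ^ 2 ≤ RCLike.re ⟪cfc f S x, x⟫_ℂ := by
  have hsa : IsSelfAdjoint (cfc f S) := cfc_predicate f S
  have hsq : cfc f S * cfc f S ≤ cfc f S := by
    rw [← cfc_mul f f S hf hf]
    exact cfc_mono (fun t ht => mul_le_of_le_one_left (h0 t ht) (h1 t ht)) (hf.mul hf) hf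
  have hle := (le_iff_re_inner (by rw [IsSelfAdjoint, star_mul, hsa]) hsa).1 hsq x
  have hsymm : ⟪(cfc f S * cfc f S) x, x⟫_ℂ = ⟪cfc f S x, cfc f S x⟫_ℂ :=
    ContinuousLinearMap.isSelfAdjoint_iff_isSymmetric.1 hsa (cfc f S x) x
  rwa [hsymm, inner_self_eq_norm_sq] at hle

theorem norm_cfc_cutoff_apply_le (S : H →L[ℂ] H) (c : ℝ) (n : ℕ) (x : H) :
    ‖cfc (cutoff c n) S x‖ ≤ ‖x‖ := by
  have h : ‖cfc (cutoff c n) S‖ ≤ 1 := norm_cfc_le zero_le_one fun t _ => by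
    rw [Real.norm_of_nonneg (cutoff_nonneg c n t)]
    exact cutoff_le_one c n t
  simpa using (cfc (cutoff c n) S).le_of_opNorm_le h x

theorem exists_tendsto_cfc_cutoff_apply (S : H →L[ℂ] H) (c : ℝ) (x : H) :
    ∃ y, Tendsto (fun n => cfc (cutoff c n) S x) atTop (𝓝 y) := by
  have hcont : ∀ n, ContinuousOn (cutoff c n) (spectrum ℝ S) := fun n =>
    (continuous_cutoff c n).continuousOn
  refine exists_tendsto_of_sq_norm_sub_le (a := fun n => RCLike.re ⟪cfc (cutoff c n) S x, x⟫_ℂ)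
    ⟨0, ?_⟩ fun n m hnm => ?_
  · rintro _ ⟨n, rfl⟩
    exact (nonneg_iff_re_inner.1 (cfc_nonneg fun t _ => cutoff_nonneg c n t)).2 x
  · have hdiff := sq_norm_cfc_apply_le (S := S)
      (f := fun t => cutoff c n t - cutoff c m t) ((hcont n).sub (hcont m))
      (fun t _ => sub_nonneg.2 (cutoff_antitone c t hnm))
      (fun t _ => by linarith [cutoff_le_one c n t, cutoff_nonneg c m t]) x
    rw [cfc_sub (cutoff c n) (cutoff c m) S (hcont n) (hcont m)] at hdiff
    simpa [inner_sub_left, norm_sub_rev (cfc (cutoff c m) S x)] using hdiff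

theorem exists_tendsto_cfc_cutoff (S : H →L[ℂ] H) (c : ℝ) :
    ∃ Q : H →L[ℂ] H, ∀ x, Tendsto (fun n => cfc (cutoff c n) S x) atTop (𝓝 (Q x)) := by
  choose q hq using exists_tendsto_cfc_cutoff_apply S c
  exact ⟨continuousLinearMapOfTendsto _ (tendsto_pi_nhds.2 hq), hq⟩

/-- The spectral projection of the self-adjoint operator `S` to `[c, ∞)`, as the strong limit of
continuous functions of `S`. -/
noncomputable def spectralCutoff (S : H →L[ℂ] H) (c : ℝ) : H →L[ℂ] H :=
  (exists_tendsto_cfc_cutoff S c).choose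

theorem tendsto_cfc_cutoff (S : H →L[ℂ] H) (c : ℝ) (x : H) :
    Tendsto (fun n => cfc (cutoff c n) S x) atTop (𝓝 (spectralCutoff S c x)) :=
  (exists_tendsto_cfc_cutoff S c).choose_spec x

theorem norm_spectralCutoff_apply_le (S : H →L[ℂ] H) (c : ℝ) (x : H) :
    ‖spectralCutoff S c x‖ ≤ ‖x‖ :=
  le_of_tendsto (tendsto_cfc_cutoff S c x).norm
    (Eventually.of_forall fun n => norm_cfc_cutoff_apply_le S c n x)

theorem spectralCutoff_intertwine {K : Type*} [NormedAddCommGroup K] [InnerProductSpace ℂ K]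
    [CompleteSpace K] {Y : K →L[ℂ] K} {J : H →L[ℂ] K} (hS : IsSelfAdjoint S)
    (hY : IsSelfAdjoint Y) (h : J.comp S = Y.comp J) (c : ℝ) (x : H) :
    J (spectralCutoff S c x) = spectralCutoff Y c (J x) := by
  refine tendsto_nhds_unique ((J.continuous.tendsto _).comp (tendsto_cfc_cutoff S c x))
    ((tendsto_cfc_cutoff Y c (J x)).congr fun n => ?_)
  exact (congrArg (fun T => T x) (comp_cfc_eq_of_comp_eq hS hY h (continuous_cutoff c n))).symm

theorem norm_sub_cfc_cutoff_le (hS : 0 ≤ S) {c : ℝ} (hc : 0 ≤ c) (n : ℕ) (x : H) :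
    ‖S x - cfc (cutoff c n) S (S x)‖ ≤ c * ‖x‖ := by
  have hsa : IsSelfAdjoint S := (nonneg_iff_re_inner.1 hS).1
  have hcont := (continuous_cutoff c n).continuousOn (s := spectrum ℝ S)
  have hcfc : S - cfc (cutoff c n) S * S = cfc (fun t => t - cutoff c n t * t) S := by
    rw [cfc_sub (fun t => t) (fun t => cutoff c n t * t) S continuousOn_id
      (hcont.mul continuousOn_id), cfc_mul (cutoff c n) (fun t => t) S hcont continuousOn_id,
      cfc_id' ℝ S]
  have hnorm : ‖S - cfc (cutoff c n) S * S‖ ≤ c := by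
    rw [hcfc]
    refine norm_cfc_le hc fun t ht => ?_
    have ht0 : 0 ≤ t := spectrum_nonneg_of_nonneg hS ht
    have h0 := cutoff_nonneg c n t
    have h1 := cutoff_le_one c n t
    rcases le_total c t with hct | hct
    · rw [cutoff_eq_one n hct]
      simpa using hc
    · rw [Real.norm_of_nonneg (by nlinarith)]
      nlinarith
  exact (S - cfc (cutoff c n) S * S).le_of_opNorm_le hnorm x

theorem norm_sub_spectralCutoff_le (hS : 0 ≤ S) {c : ℝ} (hc : 0 ≤ c) (x : H) :
    ‖S x - spectralCutoff S c (S x)‖ ≤ c * ‖x‖ :=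
  le_of_tendsto ((tendsto_cfc_cutoff S c (S x)).const_sub (S x)).norm
    (Eventually.of_forall fun n => norm_sub_cfc_cutoff_le hS hc n x)

theorem tendsto_spectralCutoff (hS : 0 ≤ S) (hd : DenseRange S) (x : H) :
    Tendsto (fun c => spectralCutoff S c x) (𝓝[≥] 0) (𝓝 x) := by
  rw [Metric.tendsto_nhds]
  intro ε hε
  obtain ⟨y, hy⟩ := hd.exists_dist_lt x (show 0 < ε / 3 by positivity)
  rw [dist_eq_norm] at hy
  have hlim : Tendsto (fun c : ℝ => c * ‖y‖) (𝓝[≥] 0) (𝓝 0) :=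
    ((continuous_id.mul continuous_const).tendsto' 0 0 (zero_mul _)).mono_left nhdsWithin_le_nhds
  filter_upwards [hlim.eventually_lt_const (show 0 < ε / 3 by positivity), self_mem_nhdsWithin]
    with c hc hc0
  have hsplit : spectralCutoff S c x - x =
      spectralCutoff S c (x - S y) - (S y - spectralCutoff S c (S y)) - (x - S y) := by
    rw [map_sub]
    abel
  rw [dist_eq_norm, hsplit]
  linarith [norm_sub_le (spectralCutoff S c (x - S y) - (S y - spectralCutoff S c (S y))) (x - S y),
    norm_sub_le (spectralCutoff S c (x - S y)) (S y - spectralCutoff S c (S y)),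
    norm_spectralCutoff_apply_le S c (x - S y), norm_sub_spectralCutoff_le hS hc0 y]

end Cutoff

theorem re_inner_algebraMap {H : Type*} [NormedAddCommGroup H] [InnerProductSpace ℂ H] (c : ℝ)
    (x : H) : RCLike.re ⟪algebraMap ℝ (H →L[ℂ] H) c x, x⟫_ℂ = c * ‖x‖ ^ 2 := by
  have hsmul : algebraMap ℝ (H →L[ℂ] H) c x = (c : ℂ) • x := by
    simp [Algebra.algebraMap_eq_smul_one]
  rw [hsmul, inner_smul_left, Complex.conj_ofReal, RCLike.re_to_complex, Complex.re_ofReal_mul,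
    ← RCLike.re_to_complex, inner_self_eq_norm_sq]

section InvariantSubspace

variable {H : Type*} [NormedAddCommGroup H] [InnerProductSpace ℂ H] [CompleteSpace H]
  {S P : H →L[ℂ] H} {c k : ℝ}

theorem isSelfAdjoint_mul_add (hS : IsSelfAdjoint S) (hP : IsStarProjection P)
    (hSP : Commute S P) : IsSelfAdjoint (S * P + c • (1 - P)) := by
  refine IsSelfAdjoint.add ?_ (IsSelfAdjoint.smul (IsSelfAdjoint.all c)
    ((IsSelfAdjoint.one _).sub hP.isSelfAdjoint))
  rw [IsSelfAdjoint, star_mul, hP.isSelfAdjoint, hS, hSP]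

theorem re_inner_mul_add (hP : IsStarProjection P) (hSP : Commute S P) (x : H) :
    RCLike.re ⟪(S * P + c • (1 - P)) x, x⟫_ℂ =
      RCLike.re ⟪S (P x), P x⟫_ℂ - c * ‖P x‖ ^ 2 + c * ‖x‖ ^ 2 := by
  have hsymm := ContinuousLinearMap.isSelfAdjoint_iff_isSymmetric.1 hP.isSelfAdjoint
  have hidem : P (P x) = P x := congrArg (fun T => T x) hP.isIdempotentElem
  have hSPx : ⟪S (P x), x⟫_ℂ = ⟪S (P x), P x⟫_ℂ := by
    have hrange : P (S (P x)) = S (P x) := by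
      rw [← show S (P (P x)) = P (S (P x)) from congrArg (fun T => T (P x)) hSP, hidem]
    calc ⟪S (P x), x⟫_ℂ = ⟪P (S (P x)), x⟫_ℂ := by rw [hrange]
      _ = ⟪S (P x), P x⟫_ℂ := hsymm _ _
  have hPx : RCLike.re ⟪P x, x⟫_ℂ = ‖P x‖ ^ 2 := by
    rw [← hidem, show ⟪P (P x), x⟫_ℂ = ⟪P x, P x⟫_ℂ from hsymm _ _, hidem]
    exact inner_self_eq_norm_sq _
  have hx : RCLike.re ⟪x, x⟫_ℂ = ‖x‖ ^ 2 := inner_self_eq_norm_sq _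
  have happly : (S * P + c • (1 - P)) x = S (P x) + (c : ℂ) • (x - P x) := by simp
  rw [happly, inner_add_left, inner_smul_left, inner_sub_left, hSPx]
  simp only [Complex.conj_ofReal, map_add, RCLike.re_to_complex, Complex.re_ofReal_mul,
    Complex.sub_re] at hPx hx ⊢
  rw [hPx, hx]
  ring

/-- The spectrum of `S` on the range of `P` is controlled by that of `S P + c (1 - P)`. -/
theorem cfc_apply_of_range (hS : IsSelfAdjoint S) (hP : IsStarProjection P)
    (hSP : Commute S P) {f : ℝ → ℝ} (hf : Continuous f)
    (hk : ∀ t ∈ spectrum ℝ (S * P + c • (1 - P)), f t = k) {x : H} (hx : P x = x) :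
    cfc f S x = k • x := by
  set W := S * P + c • (1 - P) with hW
  have hWsa : IsSelfAdjoint W := isSelfAdjoint_mul_add hS hP hSP
  have hidem : P * P = P := hP.isIdempotentElem
  have hPW : P.comp W = S.comp P := by
    change P * W = S * P
    rw [hW, mul_add, ← mul_assoc, ← hSP.eq, mul_assoc, hidem, mul_smul_comm, mul_sub, hidem,
      mul_one, sub_self, smul_zero, add_zero]
  have hcfcW : cfc f W = algebraMap ℝ _ k := by
    rw [cfc_congr (g := fun _ => k) hk, cfc_const k W]
  have hcomp := congrArg (fun T => T x) (comp_cfc_eq_of_comp_eq hWsa hS hPW hf)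
  simp only [ContinuousLinearMap.coe_comp, Function.comp_apply, hx, hcfcW] at hcomp
  rw [← hcomp, Algebra.algebraMap_eq_smul_one, smul_apply, one_apply_eq_self,
    P.map_smul_of_tower, hx]

theorem cfc_cutoff_apply_of_le (hS : IsSelfAdjoint S) (hP : IsStarProjection P)
    (hSP : Commute S P) (h : ∀ x, P x = x → c * ‖x‖ ^ 2 ≤ RCLike.re ⟪S x, x⟫_ℂ) (n : ℕ)
    {x : H} (hx : P x = x) : cfc (cutoff c n) S x = x := by
  have hle : algebraMap ℝ (H →L[ℂ] H) c ≤ S * P + c • (1 - P) := by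
    rw [le_iff_re_inner (IsSelfAdjoint.algebraMap _ (IsSelfAdjoint.all c))
      (isSelfAdjoint_mul_add hS hP hSP)]
    intro y
    rw [re_inner_mul_add hP hSP, re_inner_algebraMap]
    linarith [h (P y) (congrArg (fun T => T y) hP.isIdempotentElem)]
  rw [algebraMap_le_iff_le_spectrum (ha := isSelfAdjoint_mul_add hS hP hSP)] at hle
  simpa using cfc_apply_of_range (k := 1) hS hP hSP (continuous_cutoff c n)
    (fun t ht => cutoff_eq_one n (hle t ht)) hx

theorem cfc_cutoff_apply_of_ge {c' : ℝ} (hS : IsSelfAdjoint S) (hP : IsStarProjection P)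
    (hSP : Commute S P) (h : ∀ x, P x = x → RCLike.re ⟪S x, x⟫_ℂ ≤ c' * ‖x‖ ^ 2) {n : ℕ}
    (hn : 1 ≤ ((n : ℝ) + 1) * (c - c')) {x : H} (hx : P x = x) : cfc (cutoff c n) S x = 0 := by
  have hle : S * P + c' • (1 - P) ≤ algebraMap ℝ (H →L[ℂ] H) c' := by
    rw [le_iff_re_inner (isSelfAdjoint_mul_add hS hP hSP)
      (IsSelfAdjoint.algebraMap _ (IsSelfAdjoint.all c'))]
    intro y
    rw [re_inner_mul_add hP hSP, re_inner_algebraMap]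
    linarith [h (P y) (congrArg (fun T => T y) hP.isIdempotentElem)]
  rw [le_algebraMap_iff_spectrum_le (ha := isSelfAdjoint_mul_add hS hP hSP)] at hle
  simpa using cfc_apply_of_range (k := 0) (c := c') hS hP hSP (continuous_cutoff c n)
    (fun t ht => cutoff_eq_zero (hn.trans (by
      gcongr
      exact hle t ht))) hx

theorem spectralCutoff_apply_eq_self (hS : IsSelfAdjoint S) (hP : IsStarProjection P)
    (hSP : Commute S P) (h : ∀ x, P x = x → c * ‖x‖ ^ 2 ≤ RCLike.re ⟪S x, x⟫_ℂ)
    {x : H} (hx : P x = x) : spectralCutoff S c x = x :=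
  tendsto_nhds_unique (tendsto_cfc_cutoff S c x)
    (tendsto_const_nhds.congr fun n => (cfc_cutoff_apply_of_le hS hP hSP h n hx).symm)

theorem spectralCutoff_apply_eq_zero {c' : ℝ} (hc : c' < c) (hS : IsSelfAdjoint S)
    (hP : IsStarProjection P) (hSP : Commute S P)
    (h : ∀ x, P x = x → RCLike.re ⟪S x, x⟫_ℂ ≤ c' * ‖x‖ ^ 2)
    {x : H} (hx : P x = x) : spectralCutoff S c x = 0 := by
  obtain ⟨N, hN⟩ := exists_nat_gt (c - c')⁻¹
  refine tendsto_nhds_unique (tendsto_cfc_cutoff S c x) (tendsto_const_nhds.congr' ?_)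
  filter_upwards [eventually_ge_atTop N] with n hn
  refine (cfc_cutoff_apply_of_ge hS hP hSP h ?_ hx).symm
  have hNn : (N : ℝ) ≤ n := by exact_mod_cast hn
  rw [← div_le_iff₀ (sub_pos.2 hc), one_div]
  linarith

end InvariantSubspace

/-! ### Spectral measures -/

section SpectralMeasure

open MeasureTheory

variable {H : Type*} [NormedAddCommGroup H] [InnerProductSpace ℂ H] [CompleteSpace H]

namespace ProjectionValuedMeasure

variable (E : ProjectionValuedMeasure H) {S T : Set ℝ}

theorem scalarMeasure_apply (x : H) (hS : MeasurableSet S) :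
    E.scalarMeasure x S = ENNReal.ofReal (‖E.proj S x‖ ^ 2) :=
  Measure.ofMeasurable_apply S hS

instance isFiniteMeasure_scalarMeasure (x : H) : IsFiniteMeasure (E.scalarMeasure x) :=
  ⟨by rw [E.scalarMeasure_apply x MeasurableSet.univ]; exact ENNReal.ofReal_lt_top⟩

theorem norm_proj_apply_le (hS : MeasurableSet S) (x : H) : ‖E.proj S x‖ ≤ ‖x‖ := by
  simpa using (E.proj S).le_of_opNorm_le (E.isStarProjection S hS).norm_le x

theorem proj_proj (hS : MeasurableSet S) (hT : MeasurableSet T) (x : H) :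
    E.proj S (E.proj T x) = E.proj (S ∩ T) x := by
  rw [E.inter_eq_mul S T hS hT]
  rfl

theorem proj_proj_self (hS : MeasurableSet S) (x : H) : E.proj S (E.proj S x) = E.proj S x := by
  rw [E.proj_proj hS hS, Set.inter_self]

open Classical in
/-- The vector measure `S ↦ E(S) x`, with the junk value `0` on sets that are not measurable. -/
noncomputable def vectorMeasure (x : H) : VectorMeasure ℝ H where
  measureOf' S := if MeasurableSet S then E.proj S x else 0
  empty' := by simp [E.proj_empty]
  not_measurable' _ hS := if_neg hS
  m_iUnion' f hf hd := by
    simpa only [hf, MeasurableSet.iUnion hf, if_true] using E.hasSum_iUnion f hf hd x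

theorem vectorMeasure_apply (x : H) (hS : MeasurableSet S) : E.vectorMeasure x S = E.proj S x :=
  if_pos hS

theorem proj_compl (hS : MeasurableSet S) (x : H) : E.proj Sᶜ x = x - E.proj S x := by
  have h := (E.vectorMeasure x).of_compl hS
  rwa [E.vectorMeasure_apply x hS.compl, E.vectorMeasure_apply x hS,
    E.vectorMeasure_apply x MeasurableSet.univ, E.univ_eq_one] at h

theorem tendsto_proj_of_monotone {S : ℕ → Set ℝ} (hmono : Monotone S)
    (hS : ∀ n, MeasurableSet (S n)) (x : H) :
    Tendsto (fun n => E.proj (S n) x) atTop (𝓝 (E.proj (⋃ n, S n) x)) := by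
  have h := (E.vectorMeasure x).tendsto_vectorMeasure_iUnion_atTop_nat hmono hS
  rw [E.vectorMeasure_apply x (MeasurableSet.iUnion hS)] at h
  exact h.congr fun n => E.vectorMeasure_apply x (hS n)

theorem inner_proj_left (hS : MeasurableSet S) (x y : H) :
    ⟪E.proj S x, y⟫_ℂ = ⟪x, E.proj S y⟫_ℂ :=
  ContinuousLinearMap.isSelfAdjoint_iff_isSymmetric.1 (E.isStarProjection S hS).isSelfAdjoint x y

theorem inner_proj_proj_of_disjoint (hS : MeasurableSet S) (hT : MeasurableSet T)
    (h : Disjoint S T) (x y : H) : ⟪E.proj S x, E.proj T y⟫_ℂ = 0 := by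
  rw [E.inner_proj_left hS, E.proj_proj hS hT, h.inter_eq, E.proj_empty, zero_apply,
    inner_zero_right]

theorem norm_sq_eq_add_compl (hS : MeasurableSet S) (x : H) :
    ‖x‖ ^ 2 = ‖E.proj S x‖ ^ 2 + ‖E.proj Sᶜ x‖ ^ 2 := by
  have h := norm_add_sq_eq_norm_sq_add_norm_sq_of_inner_eq_zero _ _
    (E.inner_proj_proj_of_disjoint hS hS.compl disjoint_compl_right x x)
  rw [E.proj_compl hS] at h ⊢
  rw [add_sub_cancel] at h
  simpa [sq] using h

theorem scalarMeasure_proj (hS : MeasurableSet S) (x : H) :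
    E.scalarMeasure (E.proj S x) = (E.scalarMeasure x).restrict S := by
  ext T hT
  rw [Measure.restrict_apply hT, E.scalarMeasure_apply _ hT,
    E.scalarMeasure_apply _ (hT.inter hS), E.proj_proj hT hS]

/-- The orthogonal parts in complementary spectral subspaces stay orthogonal under every `E(T)`, so
their relative phase `ω` is invisible to the scalar measure. -/
theorem scalarMeasure_add_smul (hS : MeasurableSet S) (x y : H) {ω : ℂ} (hω : ‖ω‖ = 1) :
    E.scalarMeasure (E.proj S x + ω • E.proj Sᶜ y) =
      E.scalarMeasure (E.proj S x) + E.scalarMeasure (E.proj Sᶜ y) := by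
  ext T hT
  rw [Measure.add_apply, E.scalarMeasure_apply _ hT, E.scalarMeasure_apply _ hT,
    E.scalarMeasure_apply _ hT, ← ENNReal.ofReal_add (by positivity) (by positivity), map_add,
    map_smul, E.proj_proj hT hS, E.proj_proj hT hS.compl]
  have horth : ⟪E.proj (T ∩ S) x, ω • E.proj (T ∩ Sᶜ) y⟫_ℂ = 0 := by
    rw [inner_smul_right, E.inner_proj_proj_of_disjoint (hT.inter hS) (hT.inter hS.compl), mul_zero]
    exact disjoint_compl_right.mono Set.inter_subset_right Set.inter_subset_right
  have hpyth := norm_add_sq_eq_norm_sq_add_norm_sq_of_inner_eq_zero _ _ horth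
  rw [norm_smul, hω, one_mul, ← sq, ← sq, ← sq] at hpyth
  rw [hpyth]

end ProjectionValuedMeasure

theorem norm_sq_eq_of_mem_graph {A : H →ₗ.[ℂ] H} (hA : IsSelfAdjoint A) {x y z : H}
    (hx : (x, z) ∈ A.graph) (hz : (z, y - x) ∈ A.graph) :
    ‖y‖ ^ 2 = ‖x‖ ^ 2 + 2 * ‖z‖ ^ 2 + ‖y - x‖ ^ 2 := by
  have h := norm_sub_sq (𝕜 := ℂ) y x
  rw [← inner_conj_symm, RCLike.conj_re, re_inner_add_sq_of_mem_graph hA hx hz] at h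
  linarith

namespace IsSpectralMeasureOf

variable {A : H →ₗ.[ℂ] H} {E : ProjectionValuedMeasure H} {S : Set ℝ} {R : ℝ} {x y : H}

theorem inner_of_mem_graph (hE : IsSpectralMeasureOf A E) (h : (x, y) ∈ A.graph) :
    ⟪x, y⟫_ℂ = ((∫ l : ℝ, l ∂(E.scalarMeasure x) : ℝ) : ℂ) := by
  rw [LinearPMap.mem_graph_iff] at h
  obtain ⟨a, rfl, rfl⟩ := h
  exact hE.inner_apply a

theorem proj_mem_domain (hE : IsSpectralMeasureOf A E) (hS : MeasurableSet S)
    (hx : x ∈ A.domain) : E.proj S x ∈ A.domain := by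
  rw [hE.mem_domain_iff] at hx ⊢
  rw [E.scalarMeasure_proj hS]
  exact hx.restrict

theorem proj_mem_domain_of_bounded (hE : IsSpectralMeasureOf A E) (hS : MeasurableSet S)
    (hR : ∀ l ∈ S, |l| ≤ R) (x : H) : E.proj S x ∈ A.domain := by
  rw [hE.mem_domain_iff, E.scalarMeasure_proj hS]
  refine Integrable.of_bound (by fun_prop) (R ^ 2) ?_
  filter_upwards [ae_restrict_mem hS] with l hl
  rw [norm_pow, Real.norm_eq_abs]
  exact pow_le_pow_left₀ (abs_nonneg l) (hR l hl) 2

/-- Polarization: only the quadratic form of `A` is prescribed by `E`, and it does not see the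
relative phase of the two components. -/
theorem inner_proj_compl_eq_zero (hE : IsSpectralMeasureOf A E) (hS : MeasurableSet S)
    {x' y' : H} (h : (E.proj S x, y) ∈ A.graph) (h' : (E.proj Sᶜ x', y') ∈ A.graph) :
    ⟪E.proj S x, y'⟫_ℂ = 0 := by
  have hform : ∀ ω : ℂ, ‖ω‖ = 1 → ⟪E.proj S x + ω • E.proj Sᶜ x', y + ω • y'⟫_ℂ =
      ((∫ l : ℝ, l ∂(E.scalarMeasure (E.proj S x) + E.scalarMeasure (E.proj Sᶜ x')) : ℝ) : ℂ) := by
    intro ω hω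
    rw [← E.scalarMeasure_add_smul hS x x' hω]
    exact hE.inner_of_mem_graph (A.graph.add_mem h (A.graph.smul_mem ω h'))
  have hreal := (hform 1 (by simp)).trans (hform (-1) (by simp)).symm
  have himag := (hform Complex.I (by simp)).trans (hform (-Complex.I) (by simp)).symm
  simp only [inner_add_left, inner_add_right, inner_smul_left, inner_smul_right, map_one, map_neg,
    Complex.conj_I] at hreal himag
  have hsum : ⟪E.proj S x, y'⟫_ℂ + ⟪E.proj Sᶜ x', y⟫_ℂ = 0 := by linear_combination hreal / 2
  have hdiff : ⟪E.proj S x, y'⟫_ℂ - ⟪E.proj Sᶜ x', y⟫_ℂ = 0 :=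
    (mul_eq_zero.1 (by linear_combination himag / 2)).resolve_left Complex.I_ne_zero
  linear_combination (hsum + hdiff) / 2

theorem proj_eq_zero_of_mem_graph (hE : IsSpectralMeasureOf A E) (hA : IsSelfAdjoint A)
    (hS : MeasurableSet S) (h : (E.proj Sᶜ x, y) ∈ A.graph) : E.proj S y = 0 := by
  refine hA.dense_domain.eq_zero_of_inner_right ℂ fun v hv => ?_
  rw [← E.inner_proj_left hS]
  exact hE.inner_proj_compl_eq_zero hS (A.mem_graph ⟨_, hE.proj_mem_domain hS hv⟩) h

theorem proj_mem_graph (hE : IsSpectralMeasureOf A E) (hA : IsSelfAdjoint A)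
    (hS : MeasurableSet S) (h : (x, y) ∈ A.graph) : (E.proj S x, E.proj S y) ∈ A.graph := by
  have hx : x ∈ A.domain := LinearPMap.mem_domain_of_mem_graph h
  obtain ⟨y₁, hin⟩ : ∃ y₁, (E.proj S x, y₁) ∈ A.graph :=
    ⟨_, A.mem_graph ⟨_, hE.proj_mem_domain hS hx⟩⟩
  obtain ⟨y₂, hout⟩ : ∃ y₂, (E.proj Sᶜ x, y₂) ∈ A.graph :=
    ⟨_, A.mem_graph ⟨_, hE.proj_mem_domain hS.compl hx⟩⟩
  have hy₂ : E.proj S y₂ = 0 := hE.proj_eq_zero_of_mem_graph hA hS hout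
  have hy₁ : E.proj Sᶜ y₁ = 0 :=
    hE.proj_eq_zero_of_mem_graph hA hS.compl (x := x) (by rwa [compl_compl])
  have hsum := A.graph.add_mem hin hout
  rw [Prod.mk_add_mk, E.proj_compl hS, add_sub_cancel] at hsum
  have hy : y = y₁ + y₂ := A.mem_graph_snd_inj h hsum rfl
  rw [E.proj_compl hS, sub_eq_zero] at hy₁
  rwa [hy, map_add, hy₂, ← hy₁, add_zero]

theorem proj_eq_self_of_mem_graph (hE : IsSpectralMeasureOf A E) (hA : IsSelfAdjoint A)
    (hS : MeasurableSet S) (hx : E.proj S x = x) (h : (x, y) ∈ A.graph) : E.proj S y = y := by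
  have hproj := hE.proj_mem_graph hA hS h
  rw [hx] at hproj
  exact A.mem_graph_snd_inj hproj h rfl

theorem abs_re_inner_le_of_mem_graph (hE : IsSpectralMeasureOf A E) (hS : MeasurableSet S)
    (hR : ∀ l ∈ S, |l| ≤ R) (hx : E.proj S x = x) (h : (x, y) ∈ A.graph) :
    |RCLike.re ⟪x, y⟫_ℂ| ≤ R * ‖x‖ ^ 2 := by
  rw [hE.inner_of_mem_graph h, ← hx, E.scalarMeasure_proj hS, RCLike.re_to_complex,
    Complex.ofReal_re, ← Real.norm_eq_abs]
  have hint := norm_setIntegral_le_of_norm_le_const (μ := E.scalarMeasure x) (s := S)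
    (f := fun l : ℝ => l) (C := R) (measure_lt_top _ _) hR
  rwa [measureReal_def, E.scalarMeasure_apply _ hS, ENNReal.toReal_ofReal (by positivity)] at hint

/-- Polarization of the form bound at `R x ± A x`. -/
theorem norm_le_of_mem_graph (hE : IsSpectralMeasureOf A E) (hA : IsSelfAdjoint A)
    (hS : MeasurableSet S) (hR0 : 0 < R) (hR : ∀ l ∈ S, |l| ≤ R)
    (hx : E.proj S x = x) (h : (x, y) ∈ A.graph) : ‖y‖ ≤ R * ‖x‖ := by
  have hy : E.proj S y = y := hE.proj_eq_self_of_mem_graph hA hS hx h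
  obtain ⟨z, hz⟩ : ∃ z, (y, z) ∈ A.graph :=
    ⟨_, A.mem_graph ⟨y, hy ▸ hE.proj_mem_domain_of_bounded hS hR y⟩⟩
  have hplus := (le_abs_self _).trans <| hE.abs_re_inner_le_of_mem_graph hS hR
    (x := (R : ℂ) • x + y) (by rw [map_add, map_smul, hx, hy])
    (A.graph.add_mem (A.graph.smul_mem (R : ℂ) h) hz)
  have hminus := (neg_le_abs _).trans <| hE.abs_re_inner_le_of_mem_graph hS hR
    (x := (R : ℂ) • x - y) (by rw [map_sub, map_smul, hx, hy])
    (A.graph.sub_mem (A.graph.smul_mem (R : ℂ) h) hz)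
  have hxz : ⟪x, z⟫_ℂ = ⟪y, y⟫_ℂ := (inner_eq_of_mem_graph hA h hz).symm
  have hyy : Complex.re ⟪y, y⟫_ℂ = ‖y‖ ^ 2 := inner_self_eq_norm_sq (𝕜 := ℂ) y
  have hpar := parallelogram_law_with_norm ℂ ((R : ℂ) • x) y
  rw [norm_smul, Complex.norm_real, Real.norm_of_nonneg hR0.le] at hpar
  simp only [Prod.smul_mk, inner_add_left, inner_add_right, inner_sub_left, inner_sub_right,
    inner_smul_left, inner_smul_right, Complex.conj_ofReal, hxz, map_add, map_sub,
    RCLike.re_to_complex, Complex.add_re, Complex.sub_re, Complex.re_ofReal_mul, hyy]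
    at hplus hminus
  have hpolar : R * (4 * ‖y‖ ^ 2) ≤ R * (2 * ((R * ‖x‖) ^ 2 + ‖y‖ ^ 2)) := by
    linear_combination hplus + hminus + R * hpar
  have hsq := le_of_mul_le_mul_left hpolar hR0
  exact le_of_sq_le_sq (by linarith) (by positivity)

theorem mul_norm_le_of_mem_graph_of_sign (hE : IsSpectralMeasureOf A E) (hS : MeasurableSet S)
    {σ : ℝ} (hσ : |σ| = 1) (hR : ∀ l ∈ S, R ≤ σ * l) (hx : E.proj S x = x)
    (h : (x, y) ∈ A.graph) : R * ‖x‖ ≤ ‖y‖ := by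
  have hint : Integrable (fun l : ℝ => σ * l) (E.scalarMeasure x) := by
    have hsq := (hE.mem_domain_iff x).1 (LinearPMap.mem_domain_of_mem_graph h)
    refine Integrable.mono' (hsq.add (integrable_const (1 : ℝ))) (by fun_prop) ?_
    refine Eventually.of_forall fun l => ?_
    rw [norm_mul, Real.norm_eq_abs, hσ, one_mul, Real.norm_eq_abs, Pi.add_apply]
    nlinarith [sq_nonneg (|l| - 1), sq_abs l, abs_nonneg l]
  have hform : R * ‖x‖ ^ 2 ≤ σ * RCLike.re ⟪x, y⟫_ℂ := by
    have hle := setIntegral_ge_of_const_le (μ := E.scalarMeasure x) hS (measure_ne_top _ _) hR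
      hint.integrableOn
    rw [measureReal_def, E.scalarMeasure_apply _ hS, ENNReal.toReal_ofReal (by positivity), hx,
      integral_const_mul, smul_eq_mul, mul_comm] at hle
    rw [hE.inner_of_mem_graph h, RCLike.re_to_complex, Complex.ofReal_re]
    conv_rhs => rw [← hx, E.scalarMeasure_proj hS]
    exact hle
  have hcs : σ * RCLike.re ⟪x, y⟫_ℂ ≤ ‖x‖ * ‖y‖ := by
    calc σ * RCLike.re ⟪x, y⟫_ℂ ≤ |σ * RCLike.re ⟪x, y⟫_ℂ| := le_abs_self _
      _ = |RCLike.re ⟪x, y⟫_ℂ| := by rw [abs_mul, hσ, one_mul]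
      _ ≤ ‖⟪x, y⟫_ℂ‖ := RCLike.abs_re_le_norm _
      _ ≤ ‖x‖ * ‖y‖ := norm_inner_le_norm _ _
  rcases (norm_nonneg x).eq_or_lt with h0 | h0
  · rw [← h0, mul_zero]
    exact norm_nonneg y
  · exact le_of_mul_le_mul_left (by linarith) h0

theorem mul_norm_le_of_mem_graph (hE : IsSpectralMeasureOf A E) (hA : IsSelfAdjoint A)
    (hS : MeasurableSet S) (hR0 : 0 ≤ R) (hR : ∀ l ∈ S, R ≤ |l|) (hx : E.proj S x = x)
    (h : (x, y) ∈ A.graph) : R * ‖x‖ ≤ ‖y‖ := by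
  have hpart : ∀ (T : Set ℝ) (σ : ℝ), MeasurableSet T → |σ| = 1 → (∀ l ∈ T, |l| = σ * l) →
      (R * ‖E.proj T x‖) ^ 2 ≤ ‖E.proj T y‖ ^ 2 := by
    intro T σ hT hσ hl
    have hTS : E.proj (T ∩ S) (E.proj T x) = E.proj T x := by
      conv_lhs => rw [← hx]
      rw [E.proj_proj hT hS, E.proj_proj_self (hT.inter hS), ← E.proj_proj hT hS, hx]
    refine pow_le_pow_left₀ (by positivity) (hE.mul_norm_le_of_mem_graph_of_sign (hT.inter hS) hσ
      (fun l hl' => ?_) hTS (hE.proj_mem_graph hA hT h)) 2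
    rw [← hl l hl'.1]
    exact hR l hl'.2
  have hI : MeasurableSet (Set.Ici (0 : ℝ)) := measurableSet_Ici
  have hpos := hpart (Set.Ici 0) 1 hI (by simp) fun l hl => by
    rw [abs_of_nonneg hl, one_mul]
  have hneg := hpart (Set.Ici 0)ᶜ (-1) hI.compl (by simp) fun l hl => by
    rw [abs_of_neg (by simpa using hl), neg_one_mul]
  refine le_of_sq_le_sq ?_ (norm_nonneg _)
  rw [E.norm_sq_eq_add_compl hI y, mul_pow, E.norm_sq_eq_add_compl hI x, mul_add, ← mul_pow,
    ← mul_pow]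
  exact add_le_add hpos hneg

section Resolvent

variable {S₀ : H →L[ℂ] H}

theorem commute_proj (hE : IsSpectralMeasureOf A E) (hA : IsSelfAdjoint A)
    (hS₀ : IsInvOneAddSq A S₀) (hS : MeasurableSet S) : Commute S₀ (E.proj S) :=
  (hS₀.comp_eq hA hS₀ fun _ _ h => hE.proj_mem_graph hA hS h).symm

theorem proj_invOneAddSq_eq_self (hE : IsSpectralMeasureOf A E) (hA : IsSelfAdjoint A)
    (hS₀ : IsInvOneAddSq A S₀) (hS : MeasurableSet S) (hx : E.proj S x = x) :
    E.proj S (S₀ x) = S₀ x := by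
  have h := congrArg (fun T : H →L[ℂ] H => T x) (hE.commute_proj hA hS₀ hS)
  simpa [hx] using h.symm

theorem le_re_inner_of_proj_eq (hE : IsSpectralMeasureOf A E) (hA : IsSelfAdjoint A)
    (hS₀ : IsInvOneAddSq A S₀) (hS : MeasurableSet S) (hR0 : 0 < R) (hR : ∀ l ∈ S, |l| ≤ R)
    (hx : E.proj S x = x) : (1 + R ^ 2)⁻¹ * ‖x‖ ^ 2 ≤ RCLike.re ⟪S₀ x, x⟫_ℂ := by
  obtain ⟨z, hSz, hz⟩ := hS₀ x
  have hS₀x := hE.proj_invOneAddSq_eq_self hA hS₀ hS hx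
  have hzS := hE.proj_eq_self_of_mem_graph hA hS hS₀x hSz
  have h₁ := pow_le_pow_left₀ (norm_nonneg _) (hE.norm_le_of_mem_graph hA hS hR0 hR hS₀x hSz) 2
  have h₂ := pow_le_pow_left₀ (norm_nonneg _) (hE.norm_le_of_mem_graph hA hS hR0 hR hzS hz) 2
  rw [re_inner_add_sq_of_mem_graph hA hSz hz, inv_mul_le_iff₀ (by positivity),
    norm_sq_eq_of_mem_graph hA hSz hz]
  linear_combination h₁ + h₂

theorem re_inner_le_of_proj_eq (hE : IsSpectralMeasureOf A E) (hA : IsSelfAdjoint A)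
    (hS₀ : IsInvOneAddSq A S₀) (hS : MeasurableSet S) (hR0 : 0 ≤ R) (hR : ∀ l ∈ S, R ≤ |l|)
    (hx : E.proj S x = x) : RCLike.re ⟪S₀ x, x⟫_ℂ ≤ (1 + R ^ 2)⁻¹ * ‖x‖ ^ 2 := by
  obtain ⟨z, hSz, hz⟩ := hS₀ x
  have hS₀x := hE.proj_invOneAddSq_eq_self hA hS₀ hS hx
  have hzS := hE.proj_eq_self_of_mem_graph hA hS hS₀x hSz
  have h₁ := pow_le_pow_left₀ (by positivity)
    (hE.mul_norm_le_of_mem_graph hA hS hR0 hR hS₀x hSz) 2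
  have h₂ := pow_le_pow_left₀ (by positivity) (hE.mul_norm_le_of_mem_graph hA hS hR0 hR hzS hz) 2
  rw [re_inner_add_sq_of_mem_graph hA hSz hz, le_inv_mul_iff₀ (by positivity),
    norm_sq_eq_of_mem_graph hA hSz hz]
  linear_combination h₁ + h₂

theorem spectralCutoff_proj_compl_Icc (hE : IsSpectralMeasureOf A E) (hA : IsSelfAdjoint A)
    (hS₀ : IsInvOneAddSq A S₀) (hR : 0 < R) (x : H) :
    spectralCutoff S₀ (1 + R ^ 2)⁻¹ (E.proj (Set.Icc (-R) R)ᶜ x) = 0 := by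
  let T : ℕ → Set ℝ := fun k => {l | R + 1 / (k + 1) ≤ |l|}
  have hT : ∀ k, MeasurableSet (T k) := fun k => measurableSet_le measurable_const (by fun_prop)
  have hmono : Monotone T := fun k m hkm l hl => by
    refine le_trans ?_ (show R + 1 / ((k : ℝ) + 1) ≤ |l| from hl)
    gcongr
  have hUnion : ⋃ k, T k = (Set.Icc (-R) R)ᶜ := by
    ext l
    rw [Set.mem_iUnion, Set.mem_compl_iff, Set.mem_Icc, ← abs_le, not_le]
    refine ⟨fun ⟨k, hk⟩ => lt_of_lt_of_le (lt_add_of_pos_right R (by positivity)) hk, fun hl => ?_⟩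
    obtain ⟨k, hk⟩ := exists_nat_one_div_lt (sub_pos.2 hl)
    exact ⟨k, show R + 1 / ((k : ℝ) + 1) ≤ |l| by linarith⟩
  have hzero : ∀ k, spectralCutoff S₀ (1 + R ^ 2)⁻¹ (E.proj (T k) x) = 0 := fun k => by
    have hlt : (1 + (R + 1 / ((k : ℝ) + 1)) ^ 2)⁻¹ < (1 + R ^ 2)⁻¹ := by
      gcongr
      exact lt_add_of_pos_right R (by positivity)
    exact spectralCutoff_apply_eq_zero hlt (hS₀.isSelfAdjoint hA) (E.isStarProjection _ (hT k))
      (hE.commute_proj hA hS₀ (hT k)) (fun y hy => hE.re_inner_le_of_proj_eq hA hS₀ (hT k)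
        (by positivity) (fun l hl => hl) hy) (E.proj_proj_self (hT k) x)
  have hlim := E.tendsto_proj_of_monotone hmono hT x
  rw [hUnion] at hlim
  exact tendsto_nhds_unique (((spectralCutoff S₀ _).continuous.tendsto _).comp hlim)
    (tendsto_const_nhds.congr fun k => (hzero k).symm)

theorem spectralCutoff_apply (hE : IsSpectralMeasureOf A E) (hA : IsSelfAdjoint A)
    (hS₀ : IsInvOneAddSq A S₀) (hR : 0 < R) (x : H) :
    spectralCutoff S₀ (1 + R ^ 2)⁻¹ x = E.proj (Set.Icc (-R) R) x := by
  have hI : MeasurableSet (Set.Icc (-R) R) := measurableSet_Icc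
  have hin : spectralCutoff S₀ (1 + R ^ 2)⁻¹ (E.proj (Set.Icc (-R) R) x) =
      E.proj (Set.Icc (-R) R) x :=
    spectralCutoff_apply_eq_self (hS₀.isSelfAdjoint hA) (E.isStarProjection _ hI)
      (hE.commute_proj hA hS₀ hI) (fun y hy => hE.le_re_inner_of_proj_eq hA hS₀ hI hR
        (fun l hl => abs_le.2 hl) hy) (E.proj_proj_self hI x)
  have hout := hE.spectralCutoff_proj_compl_Icc hA hS₀ hR x
  rw [E.proj_compl hI, map_sub, hin, sub_eq_zero] at hout
  exact hout

end Resolvent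

end IsSpectralMeasureOf

end SpectralMeasure

/-! ### Unitary groups -/

namespace IsUnitaryGroupGeneratedBy

variable {H : Type*} [NormedAddCommGroup H] [InnerProductSpace ℂ H] [CompleteSpace H]
  {A : H →ₗ.[ℂ] H} {U : ℝ → H →L[ℂ] H}

theorem norm_apply (hU : IsUnitaryGroupGeneratedBy A U) (t : ℝ) (x : H) : ‖U t x‖ = ‖x‖ :=
  ContinuousLinearMap.norm_map_of_mem_unitary (hU.mem_unitary t) x

theorem apply_apply (hU : IsUnitaryGroupGeneratedBy A U) (s t : ℝ) (x : H) :
    U s (U t x) = U (s + t) x := by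
  rw [hU.add]
  rfl

theorem zero_apply (hU : IsUnitaryGroupGeneratedBy A U) (x : H) : U 0 x = x := by
  rw [hU.zero]
  rfl

theorem hasDerivAt_zero (hU : IsUnitaryGroupGeneratedBy A U) {x y : H} (h : (x, y) ∈ A.graph) :
    HasDerivAt (fun s => U s x) (-(Complex.I • y)) 0 := by
  obtain ⟨a, rfl, rfl⟩ := A.mem_graph_iff.1 h
  exact (hU.hasDerivAt_iff _ _).2 ⟨a.2, rfl⟩

theorem apply_mem_graph (hU : IsUnitaryGroupGeneratedBy A U) (t : ℝ) {x y : H}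
    (h : (x, y) ∈ A.graph) : (U t x, U t y) ∈ A.graph := by
  have hderiv : HasDerivAt (fun s => U s (U t x)) (U t (-(Complex.I • y))) 0 := by
    refine (((U t).restrictScalars ℝ).hasFDerivAt.comp_hasDerivAt (0 : ℝ)
      (hU.hasDerivAt_zero h)).congr_of_eventuallyEq (Eventually.of_forall fun s => ?_)
    change U s (U t x) = U t (U s x)
    rw [hU.apply_apply, hU.apply_apply, add_comm]
  obtain ⟨hx, hy⟩ := (hU.hasDerivAt_iff _ _).1 hderiv
  rw [map_neg, neg_inj, map_smul] at hy
  rw [smul_right_injective _ Complex.I_ne_zero hy]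
  exact A.mem_graph ⟨_, hx⟩

theorem hasDerivAt_map_apply {K : Type*} [NormedAddCommGroup K] [NormedSpace ℂ K]
    (hU : IsUnitaryGroupGeneratedBy A U) (J : H →L[ℂ] K) (t : ℝ) {x y : H}
    (h : (x, y) ∈ A.graph) : HasDerivAt (fun s => J (U s x)) (-(Complex.I • J (U t y))) t := by
  have hshift := hU.hasDerivAt_zero h
  rw [← sub_self t] at hshift
  have hderiv := ((J.comp (U t)).restrictScalars ℝ).hasFDerivAt.comp_hasDerivAt t
    (hshift.comp_sub_const t t)
  have hval : (J.comp (U t)).restrictScalars ℝ (-(Complex.I • y)) =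
      -(Complex.I • J (U t y)) := by
    change J (U t _) = _
    simp only [map_neg, map_smul]
  rw [hval] at hderiv
  refine hderiv.congr_of_eventuallyEq (Eventually.of_forall fun s => ?_)
  change J (U s x) = J (U t (U (s - t) x))
  rw [hU.apply_apply, add_sub_cancel]

theorem continuous_apply (hU : IsUnitaryGroupGeneratedBy A U) :
    Continuous fun p : ℝ × H => U p.1 p.2 := by
  rw [continuous_iff_continuousAt]
  rintro ⟨t, x⟩
  have htime : Tendsto (fun p : ℝ × H => U p.1 x) (𝓝 (t, x)) (𝓝 (U t x)) :=
    ((hU.continuous x).comp continuous_fst).tendsto (t, x)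
  have hspace : Tendsto (fun p : ℝ × H => U p.1 (p.2 - x)) (𝓝 (t, x)) (𝓝 0) := by
    rw [tendsto_zero_iff_norm_tendsto_zero]
    simp only [hU.norm_apply]
    have hcont : Continuous fun p : ℝ × H => ‖p.2 - x‖ := by fun_prop
    simpa using hcont.tendsto (t, x)
  simpa [ContinuousAt, ← map_add] using htime.add hspace

variable {K : Type*} [NormedAddCommGroup K] [InnerProductSpace ℂ K] {A₀ : K →ₗ.[ℂ] K}
  {J : H →L[ℂ] K}

theorem norm_map_apply [CompleteSpace K] (hU : IsUnitaryGroupGeneratedBy A U)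
    (hA : IsSelfAdjoint A) (hA₀ : IsSelfAdjoint A₀)
    (hJ : ∀ x y, (x, y) ∈ A.graph → (J x, J y) ∈ A₀.graph) (t : ℝ) (x : H) :
    ‖J (U t x)‖ = ‖J x‖ := by
  refine hA.dense_domain.induction (P := fun x => ‖J (U t x)‖ = ‖J x‖) (fun x hx => ?_)
    (isClosed_eq (by fun_prop) (by fun_prop)) x
  have hgraph := A.mem_graph ⟨x, hx⟩
  set y := A ⟨x, hx⟩
  have hconst : ∀ t, HasDerivAt (fun s => ⟪J (U s x), J (U s x)⟫_ℂ) 0 t := by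
    intro t
    have hderiv := hU.hasDerivAt_map_apply J t hgraph
    have hsymm := inner_eq_of_mem_graph hA₀ (hJ _ _ (hU.apply_mem_graph t hgraph))
      (hJ _ _ (hU.apply_mem_graph t hgraph))
    have hcancel : ⟪J (U t x), -(Complex.I • J (U t y))⟫_ℂ +
        ⟪-(Complex.I • J (U t y)), J (U t x)⟫_ℂ = 0 := by
      simp only [inner_neg_left, inner_neg_right, inner_smul_left, inner_smul_right,
        Complex.conj_I]
      rw [hsymm]
      ring
    exact hcancel ▸ hderiv.inner ℂ hderiv
  have heq := is_const_of_deriv_eq_zero (fun t => (hconst t).differentiableAt)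
    (fun t => (hconst t).deriv) t 0
  simp only [hU.zero_apply, inner_self_eq_norm_sq_to_K] at heq
  have hsq : ‖J (U t x)‖ ^ 2 = ‖J x‖ ^ 2 := by exact_mod_cast heq
  exact (pow_left_inj₀ (norm_nonneg _) (norm_nonneg _) two_ne_zero).1 hsq

theorem norm_map_apply_sub_le (hU : IsUnitaryGroupGeneratedBy A U) (hA : IsSelfAdjoint A)
    (hJ : ∀ x y, (x, y) ∈ A.graph → (J x, J y) ∈ A₀.graph)
    {C : ℝ} (hC : ∀ x y, (J x, y) ∈ A₀.graph → ‖y‖ ≤ C * ‖x‖) (t : ℝ) (x : H) :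
    ‖J (U t x) - J x‖ ≤ C * |t| * ‖x‖ := by
  refine hA.dense_domain.induction (P := fun x => ‖J (U t x) - J x‖ ≤ C * |t| * ‖x‖)
    (fun x hx => ?_) (isClosed_le (by fun_prop) (by fun_prop)) x
  have hgraph := A.mem_graph ⟨x, hx⟩
  set y := A ⟨x, hx⟩
  have hspeed : ∀ t ∈ Set.univ, ‖-(Complex.I • J (U t y))‖ ≤ C * ‖x‖ := fun t _ => by
    rw [norm_neg, norm_smul, Complex.norm_I, one_mul, ← hU.norm_apply t x]
    exact hC _ _ (hJ _ _ (hU.apply_mem_graph t hgraph))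
  have hmvt := Convex.norm_image_sub_le_of_norm_hasDerivWithin_le
    (fun t _ => (hU.hasDerivAt_map_apply J t hgraph).hasDerivWithinAt) hspeed convex_univ
    (Set.mem_univ 0) (Set.mem_univ t)
  simp only [hU.zero_apply, sub_zero, Real.norm_eq_abs] at hmvt
  linarith

end IsUnitaryGroupGeneratedBy

/-! ### Spectral truncations of the smaller space -/

section Frame

variable {H K : Type*} [NormedAddCommGroup H] [InnerProductSpace ℂ H] [NormedAddCommGroup K]
  [InnerProductSpace ℂ K]

theorem exists_norm_le_of_forall_mem_domain [CompleteSpace H] [CompleteSpace K]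
    {A₀ : K →ₗ.[ℂ] K} {J : H →L[ℂ] K} (hA₀ : A₀.IsClosed) (hdom : ∀ x, J x ∈ A₀.domain) :
    ∃ C, 0 ≤ C ∧ ∀ x y, (J x, y) ∈ A₀.graph → ‖y‖ ≤ C * ‖x‖ := by
  let T : H →ₗ[ℂ] K := A₀.toFun.comp ((J : H →ₗ[ℂ] K).codRestrict A₀.domain hdom)
  have hT : ∀ x, (J x, T x) ∈ A₀.graph := fun x => A₀.mem_graph ⟨J x, hdom x⟩
  have hcont : Continuous T := by
    refine T.continuous_of_seq_closed_graph fun u x y hu hTu => ?_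
    have hlim : Tendsto (fun n => (J (u n), T (u n))) atTop (𝓝 (J x, y)) :=
      ((J.continuous.tendsto x).comp hu).prodMk_nhds hTu
    have hmem : (J x, y) ∈ A₀.graph :=
      IsClosed.mem_of_tendsto hA₀ hlim (Eventually.of_forall fun n => hT (u n))
    exact A₀.mem_graph_snd_inj hmem (hT x) rfl
  let T' : H →L[ℂ] K := ⟨T, hcont⟩
  refine ⟨‖T'‖, norm_nonneg _, fun x y h => ?_⟩
  rw [A₀.mem_graph_snd_inj h (hT x) rfl]
  exact T'.le_opNorm x

theorem IsSpectralMeasureOf.norm_sub_proj_Icc_le [CompleteSpace K] {A₀ : K →ₗ.[ℂ] K}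
    {E : ProjectionValuedMeasure K} (hE : IsSpectralMeasureOf A₀ E) (hA₀ : IsSelfAdjoint A₀)
    {R : ℝ} (hR : 0 < R) {x y : K} (h : (x, y) ∈ A₀.graph) :
    ‖x - E.proj (Set.Icc (-R) R) x‖ ≤ ‖y‖ / R := by
  have hI : MeasurableSet (Set.Icc (-R) R) := measurableSet_Icc
  have houtside : ∀ l ∈ (Set.Icc (-R) R)ᶜ, R ≤ |l| := fun l hl => by
    rw [Set.mem_compl_iff, Set.mem_Icc, ← abs_le, not_le] at hl
    exact hl.le
  rw [← E.proj_compl hI, le_div_iff₀' hR]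
  exact (hE.mul_norm_le_of_mem_graph hA₀ hI.compl hR.le houtside (E.proj_proj_self hI.compl x)
    (hE.proj_mem_graph hA₀ hI.compl h)).trans (E.norm_proj_apply_le hI.compl y)

/-- A one-parameter group `U` together with a projection `Q` commuting with it. -/
structure IsTruncatedGroup (U : ℝ → H →L[ℂ] H) (Q : H →L[ℂ] H) : Prop where
  zero_apply : ∀ x, U 0 x = x
  apply_apply : ∀ s t x, U s (U t x) = U (s + t) x
  trunc_trunc : ∀ x, Q (Q x) = Q x
  apply_trunc : ∀ t x, U t (Q x) = Q (U t x)

/-- What the splitting method needs to know about the group `U` and the truncations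
`Q R = E([-R, R])` of `H`, embedded in `K` by `J`: they are isometric, respectively contractive, in
both norms, and they move a vector of `H` by at most `C |t|`, respectively `C / R`, in the norm of
`K`. -/
structure IsSplittingFrame (J : H →L[ℂ] K) (U : ℝ → H →L[ℂ] H) (Q : ℝ → H →L[ℂ] H) (C : ℝ) :
    Prop where
  nonneg : 0 ≤ C
  isTruncatedGroup : ∀ R, 0 < R → IsTruncatedGroup U (Q R)
  continuous_apply : Continuous fun p : ℝ × H => U p.1 p.2
  norm_apply : ∀ t x, ‖U t x‖ = ‖x‖
  norm_map_apply : ∀ t x, ‖J (U t x)‖ = ‖J x‖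
  norm_map_apply_sub_le : ∀ t x, ‖J (U t x - x)‖ ≤ C * |t| * ‖x‖
  norm_trunc_le : ∀ R, 0 < R → ∀ x, ‖Q R x‖ ≤ ‖x‖
  norm_map_trunc_le : ∀ R, 0 < R → ∀ x, ‖J (Q R x)‖ ≤ ‖J x‖
  norm_map_trunc_sub_le : ∀ R, 0 < R → ∀ x, ‖J (Q R x - x)‖ ≤ C / R * ‖x‖
  tendsto_trunc : ∀ x, Tendsto (fun R => Q R x) atTop (𝓝 x)

theorem tendsto_inv_one_add_sq_atTop :
    Tendsto (fun R : ℝ => (1 + R ^ 2)⁻¹) atTop (𝓝[≥] 0) :=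
  tendsto_nhdsWithin_iff.2 ⟨(tendsto_atTop_add_const_left _ _
    (tendsto_pow_atTop two_ne_zero)).inv_tendsto_atTop,
    Eventually.of_forall fun R => by rw [Set.mem_Ici]; positivity⟩

variable [CompleteSpace H] [CompleteSpace K] {A : H →ₗ.[ℂ] H} {A₀ : K →ₗ.[ℂ] K} {J : H →L[ℂ] K}
  {E : ProjectionValuedMeasure K} {U : ℝ → H →L[ℂ] H} {S : H →L[ℂ] H}

theorem map_spectralCutoff_eq_proj (hA : IsSelfAdjoint A) (hA₀ : IsSelfAdjoint A₀)
    (hJ : ∀ x y, (x, y) ∈ A.graph → (J x, J y) ∈ A₀.graph) (hE : IsSpectralMeasureOf A₀ E)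
    (hS : IsInvOneAddSq A S) {R : ℝ} (hR : 0 < R) (x : H) :
    J (spectralCutoff S (1 + R ^ 2)⁻¹ x) = E.proj (Set.Icc (-R) R) (J x) := by
  obtain ⟨S₀, hS₀⟩ := exists_isInvOneAddSq hA₀
  rw [spectralCutoff_intertwine (hS.isSelfAdjoint hA) (hS₀.isSelfAdjoint hA₀)
    (hS.comp_eq hA₀ hS₀ hJ), hE.spectralCutoff_apply hA₀ hS₀ hR]

theorem isTruncatedGroup_spectralCutoff (hJinj : Function.Injective J) (hA : IsSelfAdjoint A)
    (hA₀ : IsSelfAdjoint A₀) (hJ : ∀ x y, (x, y) ∈ A.graph → (J x, J y) ∈ A₀.graph)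
    (hE : IsSpectralMeasureOf A₀ E) (hU : IsUnitaryGroupGeneratedBy A U)
    (hS : IsInvOneAddSq A S) {R : ℝ} (hR : 0 < R) :
    IsTruncatedGroup U (spectralCutoff S (1 + R ^ 2)⁻¹) where
  zero_apply := hU.zero_apply
  apply_apply := hU.apply_apply
  trunc_trunc x := hJinj <| by
    simp only [map_spectralCutoff_eq_proj hA hA₀ hJ hE hS hR,
      E.proj_proj_self measurableSet_Icc]
  apply_trunc t := spectralCutoff_intertwine (hS.isSelfAdjoint hA) (hS.isSelfAdjoint hA)
    (hS.comp_eq hA hS fun _ _ h => hU.apply_mem_graph t h) _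

theorem exists_isSplittingFrame (hJinj : Function.Injective J) (hA : IsSelfAdjoint A)
    (hA₀ : IsSelfAdjoint A₀) (hdom : ∀ x : H, J x ∈ A₀.domain)
    (hJ : ∀ x y, (x, y) ∈ A.graph → (J x, J y) ∈ A₀.graph)
    (hU : IsUnitaryGroupGeneratedBy A U) (hE : IsSpectralMeasureOf A₀ E) :
    ∃ Q C, IsSplittingFrame J U Q C ∧
      ∀ R, 0 < R → ∀ x, J (Q R x) = E.proj (Set.Icc (-R) R) (J x) := by
  obtain ⟨S, hS⟩ := exists_isInvOneAddSq hA
  obtain ⟨C, hC0, hC⟩ := exists_norm_le_of_forall_mem_domain hA₀.isClosed hdom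
  have hQ : ∀ R, 0 < R → ∀ x, J (spectralCutoff S (1 + R ^ 2)⁻¹ x) =
      E.proj (Set.Icc (-R) R) (J x) := fun R hR => map_spectralCutoff_eq_proj hA hA₀ hJ hE hS hR
  refine ⟨fun R => spectralCutoff S (1 + R ^ 2)⁻¹, C, ?_, hQ⟩
  exact
    { nonneg := hC0
      isTruncatedGroup := fun R hR => isTruncatedGroup_spectralCutoff hJinj hA hA₀ hJ hE hU hS hR
      continuous_apply := hU.continuous_apply
      norm_apply := hU.norm_apply
      norm_map_apply := hU.norm_map_apply hA hA₀ hJ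
      norm_map_apply_sub_le := fun t x => by
        rw [map_sub]
        exact hU.norm_map_apply_sub_le hA hJ hC t x
      norm_trunc_le := fun R _ => norm_spectralCutoff_apply_le S _
      norm_map_trunc_le := fun R hR x => by
        rw [hQ R hR]
        exact E.norm_proj_apply_le measurableSet_Icc _
      norm_map_trunc_sub_le := fun R hR x => by
        have hgraph := A₀.mem_graph ⟨J x, hdom x⟩
        rw [map_sub, hQ R hR, norm_sub_rev, div_mul_eq_mul_div]
        exact (hE.norm_sub_proj_Icc_le hA₀ hR hgraph).trans
          (div_le_div_of_nonneg_right (hC _ _ hgraph) hR.le)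
      tendsto_trunc := fun x => (tendsto_spectralCutoff (hS.nonneg hA) (hS.denseRange hA) x).comp
        tendsto_inv_one_add_sq_atTop }

end Frame

/-! ### Local Lipschitz conditions and the flow of the nonlinearity -/

section LocallyLipschitzFor

open scoped NNReal

variable {F : Type*} [NormedAddCommGroup F] [NormedSpace ℝ F]

/-- Locally in the norm topology, the map `V` is Lipschitz for the seminorm `q`. -/
def LocallyLipschitzFor (q : Seminorm ℝ F) (V : F → F) : Prop :=
  ∀ x, ∃ L : ℝ≥0, ∃ s ∈ 𝓝 x, ∀ y ∈ s, ∀ z ∈ s, q (V y - V z) ≤ L * q (y - z)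

/-- The seminorm `x ↦ ‖J x‖`. For the embedding `J` of `H₁` into `H₀` it is the norm of `H₀`. -/
noncomputable def pullbackNorm {H X : Type*} [NormedAddCommGroup H] [NormedSpace ℂ H]
    [NormedAddCommGroup X] [NormedSpace ℂ X] (J : H →L[ℂ] X) : Seminorm ℝ H :=
  (normSeminorm ℝ X).comp (J.restrictScalars ℝ).toLinearMap

theorem pullbackNorm_apply {H X : Type*} [NormedAddCommGroup H] [NormedSpace ℂ H]
    [NormedAddCommGroup X] [NormedSpace ℂ X] (J : H →L[ℂ] X) (x : H) :
    pullbackNorm J x = ‖J x‖ :=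
  rfl

theorem locallyLipschitzFor_normSeminorm {V : F → F} (hV : LocallyLipschitz V) :
    LocallyLipschitzFor (normSeminorm ℝ F) V := fun x => by
  obtain ⟨L, s, hs, hL⟩ := hV x
  refine ⟨L, s, hs, fun y hy z hz => ?_⟩
  simpa only [dist_eq_norm, coe_normSeminorm] using hL.dist_le_mul y hy z hz

theorem locallyLipschitzFor_of_norm_sub_sub_le {H X : Type*} [NormedAddCommGroup H]
    [NormedSpace ℂ H] [NormedAddCommGroup X] [NormedSpace ℂ X] {J : H →L[ℂ] X} {V : H → H}
    {V' : H → X →L[ℝ] X}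
    (h : ∀ r > (0 : ℝ), ∃ ε C δ : ℝ, 0 < δ ∧ ∀ u w : H, ‖u‖ ≤ r → ‖w‖ < δ →
      ‖V' u‖ ≤ C ∧ ‖J (V (u + w)) - J (V u) - V' u (J w)‖ ≤ ε * ‖J w‖) :
    LocallyLipschitzFor (pullbackNorm J) V := fun x => by
  obtain ⟨ε, C, δ, hδ, hV⟩ := h (‖x‖ + 1) (by positivity)
  refine ⟨(ε + C).toNNReal, Metric.ball x (min 1 (δ / 2)), Metric.ball_mem_nhds x (by positivity),
    fun y hy z hz => ?_⟩
  rw [Metric.mem_ball, lt_min_iff] at hy hz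
  have hz_norm : ‖z‖ ≤ ‖x‖ + 1 := by
    linarith [norm_le_norm_add_norm_sub' z x, dist_eq_norm z x]
  have hyz : ‖y - z‖ < δ := by
    rw [← dist_eq_norm]
    linarith [dist_triangle_right y z x]
  obtain ⟨hbound, happrox⟩ := hV z (y - z) hz_norm hyz
  rw [add_sub_cancel] at happrox
  calc ‖J (V y - V z)‖ = ‖(J (V y) - J (V z) - V' z (J (y - z))) + V' z (J (y - z))‖ := by
        rw [map_sub, sub_add_cancel]
    _ ≤ ε * ‖J (y - z)‖ + C * ‖J (y - z)‖ :=
        (norm_add_le _ _).trans (add_le_add happrox ((V' z).le_of_opNorm_le hbound _))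
    _ ≤ (ε + C).toNNReal * ‖J (y - z)‖ := by
        rw [← add_mul]
        gcongr
        exact Real.le_coe_toNNReal _

theorem LocallyLipschitzFor.exists_forall_closedBall {q : Seminorm ℝ F} {V : F → F}
    (hV : LocallyLipschitzFor q V) {K : Set F} (hK : IsCompact K) :
    ∃ δ : ℝ, 0 < δ ∧ ∃ L : ℝ≥0, ∀ x ∈ K, ∀ y ∈ Metric.closedBall x δ,
      ∀ z ∈ Metric.closedBall x δ, q (V y - V z) ≤ L * q (y - z) := by
  refine hK.induction_on (p := fun K => ∃ δ : ℝ, 0 < δ ∧ ∃ L : ℝ≥0, ∀ x ∈ K,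
    ∀ y ∈ Metric.closedBall x δ, ∀ z ∈ Metric.closedBall x δ, q (V y - V z) ≤ L * q (y - z))
    ⟨1, one_pos, 0, fun x hx => absurd hx (Set.notMem_empty x)⟩ ?_ ?_ ?_
  · rintro s t hst ⟨δ, hδ, L, hL⟩
    exact ⟨δ, hδ, L, fun x hx => hL x (hst hx)⟩
  · rintro s t ⟨δ, hδ, L, hL⟩ ⟨δ', hδ', L', hL'⟩
    have hsub (x : F) := Metric.closedBall_subset_closedBall (x := x) (min_le_left δ δ')
    have hsub' (x : F) := Metric.closedBall_subset_closedBall (x := x) (min_le_right δ δ')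
    refine ⟨min δ δ', lt_min hδ hδ', max L L', ?_⟩
    rintro x (hx | hx) y hy z hz
    · refine (hL x hx y (hsub x hy) z (hsub x hz)).trans ?_
      gcongr
      exact le_max_left _ _
    · refine (hL' x hx y (hsub' x hy) z (hsub' x hz)).trans ?_
      gcongr
      exact le_max_right _ _
  · intro x _
    obtain ⟨L, s, hs, hL⟩ := hV x
    obtain ⟨δ, hδ, hδs⟩ := Metric.mem_nhds_iff.1 hs
    refine ⟨Metric.ball x (δ / 2), mem_nhdsWithin_of_mem_nhds
      (Metric.ball_mem_nhds x (half_pos hδ)), δ / 4, by positivity, L, fun y hy => ?_⟩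
    have hsub : Metric.closedBall y (δ / 4) ⊆ s := fun z hz => hδs <| by
      rw [Metric.mem_closedBall] at hz
      rw [Metric.mem_ball] at hy ⊢
      linarith [dist_triangle z y x]
    exact fun z hz z' hz' => hL z (hsub hz) z' (hsub hz')

theorem LocallyLipschitzFor.neg_I_smul {H X : Type*} [NormedAddCommGroup H] [NormedSpace ℂ H]
    [NormedAddCommGroup X] [NormedSpace ℂ X] {J : H →L[ℂ] X} {B : H → H}
    (hB : LocallyLipschitzFor (pullbackNorm J) B) :
    LocallyLipschitzFor (pullbackNorm J) fun x => -(Complex.I • B x) := fun x => by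
  obtain ⟨L, s, hs, hL⟩ := hB x
  refine ⟨L, s, hs, fun y hy z hz => ?_⟩
  have hrot : -(Complex.I • B y) - -(Complex.I • B z) = -(Complex.I • (B y - B z)) := by
    rw [smul_sub]
    abel
  rw [hrot, map_neg_eq_map, pullbackNorm_apply, map_smul, norm_smul, Complex.norm_I, one_mul]
  exact hL y hy z hz

/-- The barrier `s ↦ ρ s` keeps the curve in the ball where the field is bounded. -/
theorem norm_sub_le_of_isIntegralCurveOn {V : F → F} {γ : ℝ → F} {ρ M : ℝ}
    (hγ : IsIntegralCurveOn γ (fun _ => V) (Set.Icc 0 1))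
    (hM : ∀ y ∈ Metric.closedBall (γ 0) ρ, ‖V y‖ ≤ M) (hρ : 0 ≤ ρ) (hMρ : M < ρ)
    {s : ℝ} (hs : s ∈ Set.Icc (0 : ℝ) 1) : ‖γ s - γ 0‖ ≤ M := by
  have hM0 : 0 ≤ M := (norm_nonneg _).trans (hM _ (Metric.mem_closedBall_self hρ))
  have hbarrier : ∀ s ∈ Set.Icc (0 : ℝ) 1, ‖γ s - γ 0‖ ≤ ρ * s := by
    intro s hs
    refine image_norm_le_of_norm_deriv_right_lt_deriv_boundary' (f := fun s => γ s - γ 0)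
      (f' := fun s => V (γ s)) (B := fun s => ρ * s) (B' := fun _ => ρ)
      (fun s hs => (hγ s hs).continuousWithinAt.sub continuousWithinAt_const)
      (fun s hs => ((hγ s ⟨hs.1, hs.2.le⟩).mono_of_mem_nhdsWithin (mem_of_superset
        (Icc_mem_nhdsGE hs.2) (Set.Icc_subset_Icc_left hs.1))).sub_const (γ 0)) (by simp)
      (by fun_prop) (fun s _ => by simpa using ((hasDerivAt_id s).const_mul ρ).hasDerivWithinAt)
      (fun s hs heq => (hM _ ?_).trans_lt hMρ) hs
    rw [mem_closedBall_iff_norm, heq]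
    exact mul_le_of_le_one_right hρ hs.2.le
  have hspeed : ∀ s ∈ Set.Ico (0 : ℝ) 1, ‖V (γ s)‖ ≤ M := fun s hs => hM _ <| by
    rw [mem_closedBall_iff_norm]
    exact (hbarrier s ⟨hs.1, hs.2.le⟩).trans (mul_le_of_le_one_right hρ hs.2.le)
  have hmvt := norm_image_sub_le_of_norm_deriv_le_segment' hγ hspeed s hs
  rw [sub_zero] at hmvt
  exact hmvt.trans (mul_le_of_le_one_right hM0 hs.2)

theorem norm_sub_sub_le_of_isIntegralCurveOn {V : F → F} {γ : ℝ → F} {ρ M : ℝ} {L : ℝ≥0}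
    (hγ : IsIntegralCurveOn γ (fun _ => V) (Set.Icc 0 1))
    (hL : LipschitzOnWith L V (Metric.closedBall (γ 0) ρ))
    (hM : ∀ y ∈ Metric.closedBall (γ 0) ρ, ‖V y‖ ≤ M) (hρ : 0 ≤ ρ) (hMρ : M < ρ) :
    ‖γ 1 - γ 0 - V (γ 0)‖ ≤ L * M := by
  have hderiv : ∀ s ∈ Set.Icc (0 : ℝ) 1, HasDerivWithinAt (fun s => γ s - s • V (γ 0))
      (V (γ s) - V (γ 0)) (Set.Icc 0 1) s := fun s hs =>
    (hγ s hs).sub (by simpa using ((hasDerivAt_id s).smul_const (V (γ 0))).hasDerivWithinAt)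
  have hspeed : ∀ s ∈ Set.Ico (0 : ℝ) 1, ‖V (γ s) - V (γ 0)‖ ≤ L * M := fun s hs => by
    have hnear := norm_sub_le_of_isIntegralCurveOn hγ hM hρ hMρ ⟨hs.1, hs.2.le⟩
    have hlip := hL.dist_le_mul _ (mem_closedBall_iff_norm.2 (hnear.trans hMρ.le)) (γ 0)
      (Metric.mem_closedBall_self hρ)
    rw [dist_eq_norm, dist_eq_norm] at hlip
    exact hlip.trans (by gcongr)
  simpa [sub_right_comm] using norm_image_sub_le_of_norm_deriv_le_segment_01' hderiv hspeed

theorem exists_isIntegralCurveOn_of_lipschitzOnWith [CompleteSpace F] {V : F → F} {w : F} {t : ℝ}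
    {ρ L M : ℝ≥0} (hL : LipschitzOnWith L V (Metric.closedBall w ρ))
    (hM : ∀ y ∈ Metric.closedBall w ρ, ‖V y‖ ≤ M) (ht : |t| * M ≤ ρ) :
    ∃ γ : ℝ → F, γ 0 = w ∧ IsIntegralCurveOn γ (fun _ => V) (Set.uIcc 0 t) := by
  have htime : max (max 0 t - 0) (0 - min 0 t) = |t| := by
    rcases le_total 0 t with h | h
    · simp [h, abs_of_nonneg h]
    · simp [h, abs_of_nonpos h]
  refine (IsPicardLindelof.of_time_independent (r := 0)
    (t₀ := (⟨0, Set.left_mem_uIcc⟩ : Set.Icc (min 0 t) (max 0 t))) hM hL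
    ?_).exists_eq_forall_mem_Icc_hasDerivWithinAt₀
  rwa [htime, NNReal.coe_zero, sub_zero, mul_comm]

theorem exists_mem_nonlinearFlow {H : Type*} [NormedAddCommGroup H] [InnerProductSpace ℂ H]
    [CompleteSpace H] {B : H → H} {w : H} {t ρ : ℝ} {L M : ℝ≥0}
    (hL : LipschitzOnWith L (fun x => -(Complex.I • B x)) (Metric.closedBall w ρ))
    (hM : ∀ y ∈ Metric.closedBall w ρ, ‖-(Complex.I • B y)‖ ≤ M) (ht : |t| * M < ρ) :
    ∃ y ∈ nonlinearFlow B t w, ‖y - w - t • -(Complex.I • B w)‖ ≤ L * M * t ^ 2 := by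
  lift ρ to ℝ≥0 using le_trans (by positivity) ht.le
  have hex := exists_isIntegralCurveOn_of_lipschitzOnWith hL hM ht.le
  refine ⟨hex.choose t, ⟨hex, rfl⟩, ?_⟩
  obtain ⟨hw, hγ⟩ := hex.choose_spec
  set γ := hex.choose
  set V : H → H := fun x => -(Complex.I • B x)
  have hsub : Set.Icc (0 : ℝ) 1 ⊆ {s | s * t ∈ Set.uIcc 0 t} := fun s hs => by
    rw [Set.mem_ofPred_eq, ← segment_eq_uIcc]
    exact ⟨1 - s, s, by linarith [hs.2], hs.1, by ring, by simp⟩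
  have hrescaled : IsIntegralCurveOn (γ ∘ (· * t)) (fun _ => t • V) (Set.Icc 0 1) :=
    (hγ.comp_mul t).mono hsub
  have hstart : (γ ∘ (· * t)) 0 = w := by simpa using hw
  have herr := norm_sub_sub_le_of_isIntegralCurveOn (ρ := ρ) (M := |t| * M) (L := ‖t‖₊ * L)
    hrescaled (hstart.symm ▸ (lipschitzWith_smul t).comp_lipschitzOnWith hL) ?_ ρ.2 ht
  · rw [hstart] at herr
    refine (le_of_eq ?_).trans (herr.trans_eq ?_)
    · simp [V]
    · rw [NNReal.coe_mul, coe_nnnorm, Real.norm_eq_abs, ← sq_abs t]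
      ring
  · intro y hy
    rw [hstart] at hy
    rw [Pi.smul_apply, norm_smul, Real.norm_eq_abs]
    exact mul_le_mul_of_nonneg_left (hM y hy) (abs_nonneg t)

end LocallyLipschitzFor

/-! ### The Duhamel equation -/

section Duhamel

variable {H : Type*} [NormedAddCommGroup H] [InnerProductSpace ℂ H]
  {U : ℝ → H →L[ℂ] H} {B : H → H} {u₀ : H} {T : ℝ} {u v : ℝ → H}

theorem IsDuhamelSolution.mono (h : IsDuhamelSolution U B u₀ T u) {T' : ℝ} (hT : T' ≤ T) :
    IsDuhamelSolution U B u₀ T' u :=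
  ⟨h.1.mono (Set.Icc_subset_Icc_right hT), fun t ht => h.2 t (Set.Icc_subset_Icc_right hT ht)⟩

theorem exists_isDuhamelSolution_of_lt_maximalTime (h : (T : EReal) < maximalTime U B u₀) :
    ∃ u, IsDuhamelSolution U B u₀ T u := by
  obtain ⟨_, ⟨T', -, rfl, u, hu⟩, hlt⟩ := lt_sSup_iff.1 h
  exact ⟨u, hu.mono (EReal.coe_lt_coe_iff.1 hlt).le⟩

variable [CompleteSpace H] {A : H →ₗ.[ℂ] H}

theorem IsUnitaryGroupGeneratedBy.apply_neg_apply (hU : IsUnitaryGroupGeneratedBy A U) (t : ℝ)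
    (x : H) : U t (U (-t) x) = x := by
  rw [hU.apply_apply, add_neg_cancel, hU.zero_apply]

theorem IsUnitaryGroupGeneratedBy.lipschitzOnWith_conj (hU : IsUnitaryGroupGeneratedBy A U)
    {L : NNReal} {K : Set H} (hL : LipschitzOnWith L B K) (t : ℝ) :
    LipschitzOnWith L (fun x => U (-t) (-(Complex.I • B (U t x)))) {x | U t x ∈ K} :=
  LipschitzOnWith.of_dist_le_mul fun x hx y hy => by
    have hlip := hL.dist_le_mul _ hx _ hy
    rw [dist_eq_norm, dist_eq_norm, ← map_sub, hU.norm_apply] at hlip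
    rwa [dist_eq_norm, ← map_sub, hU.norm_apply, neg_sub_neg, ← smul_sub, norm_smul,
      Complex.norm_I, one_mul, dist_eq_norm, norm_sub_rev]

namespace IsDuhamelSolution

theorem continuousOn_integrand (hU : IsUnitaryGroupGeneratedBy A U) (hB : Continuous B)
    (h : IsDuhamelSolution U B u₀ T u) :
    ContinuousOn (fun s => U (-s) (-(Complex.I • B (u s)))) (Set.Icc 0 T) :=
  hU.continuous_apply.comp_continuousOn
    (continuousOn_id.neg.prodMk ((hB.comp_continuousOn h.1).const_smul Complex.I).neg)

theorem apply_neg_eq (hU : IsUnitaryGroupGeneratedBy A U) (hB : Continuous B)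
    (h : IsDuhamelSolution U B u₀ T u) {t : ℝ} (ht : t ∈ Set.Icc 0 T) :
    U (-t) (u t) = u₀ + ∫ s in (0 : ℝ)..t, U (-s) (-(Complex.I • B (u s))) := by
  have hint : IntervalIntegrable (fun s => U (t - s) (B (u s))) MeasureTheory.volume 0 t := by
    refine ContinuousOn.intervalIntegrable ?_
    rw [Set.uIcc_of_le ht.1]
    exact hU.continuous_apply.comp_continuousOn ((continuousOn_const.sub continuousOn_id).prodMk
      (hB.comp_continuousOn (h.1.mono (Set.Icc_subset_Icc_right ht.2))))
  rw [h.2 t ht, map_sub, hU.apply_apply, neg_add_cancel, hU.zero_apply, map_smul,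
    ← ContinuousLinearMap.intervalIntegral_comp_comm _ hint, sub_eq_add_neg,
    ← intervalIntegral.integral_smul, ← intervalIntegral.integral_neg]
  congr 1
  refine intervalIntegral.integral_congr fun s _ => ?_
  simp only [hU.apply_apply, map_neg, map_smul]
  rw [show -t + (t - s) = -s by ring]

theorem eq_add_integral (hU : IsUnitaryGroupGeneratedBy A U) (hB : Continuous B)
    (h : IsDuhamelSolution U B u₀ T u) {s t : ℝ} (hs : s ∈ Set.Icc 0 T) (ht : t ∈ Set.Icc 0 T) :
    u t = U (t - s) (u s) + ∫ r in s..t, U (t - r) (-(Complex.I • B (u r))) := by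
  have hint : ∀ {a b}, a ∈ Set.Icc 0 T → b ∈ Set.Icc 0 T → IntervalIntegrable
      (fun s => U (-s) (-(Complex.I • B (u s)))) MeasureTheory.volume a b := fun ha hb =>
    ((h.continuousOn_integrand hU hB).mono
      (Set.ordConnected_Icc.uIcc_subset ha hb)).intervalIntegrable
  have h0 : (0 : ℝ) ∈ Set.Icc 0 T := ⟨le_rfl, hs.1.trans hs.2⟩
  have hinteraction : U (-t) (u t) =
      U (-s) (u s) + ∫ r in s..t, U (-r) (-(Complex.I • B (u r))) := by
    rw [h.apply_neg_eq hU hB hs, h.apply_neg_eq hU hB ht, add_assoc,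
      intervalIntegral.integral_add_adjacent_intervals (hint h0 hs) (hint hs ht)]
  have happly := congrArg (U t) hinteraction
  rw [hU.apply_neg_apply, map_add, hU.apply_apply,
    ← ContinuousLinearMap.intervalIntegral_comp_comm _ (hint hs ht)] at happly
  simpa only [hU.apply_apply, ← sub_eq_add_neg] using happly

theorem hasDerivWithinAt (hU : IsUnitaryGroupGeneratedBy A U) (hB : Continuous B)
    (h : IsDuhamelSolution U B u₀ T u) {t : ℝ} (ht : t ∈ Set.Ico 0 T) :
    HasDerivWithinAt (fun s => U (-s) (u s)) (U (-t) (-(Complex.I • B (u t)))) (Set.Ici t) t := by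
  have hT : (0 : ℝ) ≤ T := ht.1.trans ht.2.le
  set g := fun s => U (-s) (-(Complex.I • B (u s)))
  set G := Set.IccExtend hT ((Set.Icc 0 T).domRestrict g)
  have hG : Continuous G := (h.continuousOn_integrand hU hB).domRestrict.Icc_extend'
  have hGg : ∀ s ∈ Set.Icc 0 T, G s = g s := fun s hs => Set.IccExtend_of_mem hT _ hs
  have ht' : t ∈ Set.Icc 0 T := ⟨ht.1, ht.2.le⟩
  have hderiv : HasDerivAt (fun s => u₀ + ∫ r in (0 : ℝ)..s, G r) (g t) t :=
    hGg t ht' ▸ (hG.integral_hasStrictDerivAt 0 t).hasDerivAt.const_add u₀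
  have hprimitive : ∀ s ∈ Set.Icc 0 T, U (-s) (u s) = u₀ + ∫ r in (0 : ℝ)..s, G r :=
    fun s hs => by
    rw [h.apply_neg_eq hU hB hs]
    congr 1
    refine intervalIntegral.integral_congr fun r hr => (hGg r ?_).symm
    rw [Set.uIcc_of_le hs.1] at hr
    exact Set.Icc_subset_Icc_right hs.2 hr
  refine hderiv.hasDerivWithinAt.congr_of_eventuallyEq ?_ (hprimitive t ht')
  filter_upwards [Icc_mem_nhdsGE ht.2] with s hs
  exact hprimitive s ⟨ht.1.trans hs.1, hs.2⟩

theorem apply_zero (hU : IsUnitaryGroupGeneratedBy A U) (hT : 0 ≤ T)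
    (h : IsDuhamelSolution U B u₀ T u) : u 0 = u₀ := by
  rw [h.2 0 ⟨le_rfl, hT⟩, intervalIntegral.integral_same, smul_zero, sub_zero, hU.zero_apply]

theorem eqOn (hU : IsUnitaryGroupGeneratedBy A U) (hB : LocallyLipschitz B)
    (hu : IsDuhamelSolution U B u₀ T u) (hv : IsDuhamelSolution U B u₀ T v) :
    Set.EqOn u v (Set.Icc 0 T) := by
  rcases lt_or_ge T 0 with hT | hT
  · simp [Set.Icc_eq_empty (not_le.2 hT)]
  set K := u '' Set.Icc 0 T ∪ v '' Set.Icc 0 T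
  have hK : IsCompact K := (isCompact_Icc.image_of_continuousOn hu.1).union
    (isCompact_Icc.image_of_continuousOn hv.1)
  obtain ⟨L, hL⟩ := hB.locallyLipschitzOn.exists_lipschitzOnWith_of_compact hK
  have hcont : ∀ {u}, IsDuhamelSolution U B u₀ T u →
      ContinuousOn (fun s => U (-s) (u s)) (Set.Icc 0 T) := fun h =>
    hU.continuous_apply.comp_continuousOn (continuousOn_id.neg.prodMk h.1)
  have hderiv : ∀ {u}, IsDuhamelSolution U B u₀ T u → ∀ t ∈ Set.Ico 0 T,
      HasDerivWithinAt (fun s => U (-s) (u s))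
        (U (-t) (-(Complex.I • B (U t (U (-t) (u t)))))) (Set.Ici t) t := fun h t ht => by
    simpa only [hU.apply_neg_apply] using h.hasDerivWithinAt hU hB.continuous ht
  have hmem : ∀ {w : ℝ → H} {t}, w t ∈ K → U (-t) (w t) ∈ {x | U t x ∈ K} := fun h => by
    rwa [Set.mem_ofPred_eq, hU.apply_neg_apply]
  have hinteraction := ODE_solution_unique_of_mem_Icc_right (s := fun t => {x | U t x ∈ K})
    (fun t _ => hU.lipschitzOnWith_conj hL t) (hcont hu) (hderiv hu)
    (fun t ht => hmem (Or.inl ⟨t, ⟨ht.1, ht.2.le⟩, rfl⟩)) (hcont hv) (hderiv hv)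
    (fun t ht => hmem (Or.inr ⟨t, ⟨ht.1, ht.2.le⟩, rfl⟩))
    (by rw [hu.apply_zero hU hT, hv.apply_zero hU hT])
  intro t ht
  simpa only [hU.apply_neg_apply] using congrArg (U t) (hinteraction ht)

theorem mem_exactFlow (hU : IsUnitaryGroupGeneratedBy A U) (hB : LocallyLipschitz B)
    (hu : IsDuhamelSolution U B u₀ T u) {t : ℝ} (ht : t ∈ Set.Icc 0 T) :
    u t ∈ exactFlow U B t u₀ := by
  have hdom : 0 ≤ t ∧ ∃ u, IsDuhamelSolution U B u₀ t u := ⟨ht.1, u, hu.mono ht.2⟩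
  exact ⟨hdom, hdom.2.choose_spec.eqOn hU hB (hu.mono ht.2) ⟨ht.1, le_rfl⟩⟩

end IsDuhamelSolution

end Duhamel
/-! ### Error propagation of the splitting scheme -/

section SplittingError

variable {H : Type*} [NormedAddCommGroup H]

/-- On the `δ`-tube around the set `K`, the field `V` is bounded by `κ` and `κ`-Lipschitz, both in
the seminorm `q`. -/
structure IsLipschitzTube [NormedSpace ℝ H] (q : Seminorm ℝ H) (V : H → H) (K : Set H) (δ κ : ℝ) :
    Prop where
  seminorm_sub_le : ∀ x ∈ K, ∀ y ∈ Metric.closedBall x δ, ∀ z ∈ Metric.closedBall x δ,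
    q (V y - V z) ≤ κ * q (y - z)
  seminorm_le : ∀ x ∈ K, ∀ y ∈ Metric.closedBall x δ, q (V y) ≤ κ

variable [InnerProductSpace ℂ H]

/-- The approximation of `u(t + h)` that the scheme with step size `h` follows within a step that
starts at `x = u(t)`: `s` and `r` are the times for which the linear group and the field `V` have
acted so far, and `s = r = h` gives a first-order quadrature of Duhamel's formula. -/
noncomputable def substepTarget (U : ℝ → H →L[ℂ] H) (Q : H →L[ℂ] H) (V : H → H) (x : H)
    (s r : ℝ) : H :=
  U s (Q x) + r • V x

/-- Consistency, in the seminorm `q` and with error `η`, of a scheme of step size `h` with the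
curve `u` on `[0, T]`. The constant `κ` bounds the data of the problem, including the total size
`∑ |a_j|`, `∑ |b_j|` of the substeps. -/
structure SplittingConsistency (q : Seminorm ℝ H) (U : ℝ → H →L[ℂ] H) (Q : H →L[ℂ] H) (V : H → H)
    (u : ℝ → H) (T h δ κ η : ℝ) : Prop where
  seminorm_le : ∀ y, q y ≤ κ * ‖y‖
  seminorm_apply : ∀ t y, q (U t y) = q y
  seminorm_trunc_le : ∀ y, q (Q y) ≤ q y
  isLipschitzTube : IsLipschitzTube q V (u '' Set.Icc 0 T) δ κ
  curve_le : ∀ t ∈ Set.Icc 0 T, ∀ τ, |τ| ≤ κ * h → q (U τ (Q (u t)) - u t) ≤ η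
  field_le : ∀ t ∈ Set.Icc 0 T, ∀ τ, |τ| ≤ κ * h → q (U τ (Q (V (u t))) - V (u t)) ≤ η
  step_le : ∀ t ∈ Set.Icc 0 T, t + h ∈ Set.Icc 0 T →
    q (Q (u (t + h)) - substepTarget U Q V (u t) h h) ≤ h * η

/-- The linear and the nonlinear substeps of a scheme of step size `h`: the linear substep is
`U s ∘ Q`, and the nonlinear one is defined near the curve `u` and is Euler's method for the field
`V` up to second order. -/
structure IsSplittingPair (U : ℝ → H →L[ℂ] H) (Q : H →L[ℂ] H) (V : H → H) (u : ℝ → H)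
    (ΨA ΦB : ℝ → H → Part H) (T h δ κ : ℝ) : Prop where
  isTruncatedGroup : IsTruncatedGroup U Q
  apply_trunc_mem : ∀ s y, U s (Q y) ∈ ΨA s y
  exists_mem_flow : ∀ t ∈ Set.Icc 0 T, ∀ w, ‖w - u t‖ ≤ δ / 2 → ∀ b, |b| ≤ κ * h →
    ∃ y ∈ ΦB b w, ‖y - w - b • V w‖ ≤ κ ^ 2 * b ^ 2

variable {q : Seminorm ℝ H} {U : ℝ → H →L[ℂ] H} {Q : H →L[ℂ] H} {V : H → H} {u : ℝ → H}
  {T h δ κ η η₁ : ℝ}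

namespace SplittingConsistency

variable {t τ σ β b : ℝ} {y w y' : H}

theorem nonneg (hc : SplittingConsistency q U Q V u T h δ κ η) (hκh : 0 ≤ κ * h)
    (ht : t ∈ Set.Icc 0 T) : 0 ≤ η :=
  (apply_nonneg q _).trans (hc.curve_le t ht 0 (by rwa [abs_zero]))

theorem seminorm_linear_sub_le (hc : SplittingConsistency q U Q V u T h δ κ η)
    (hQ : IsTruncatedGroup U Q) (ht : t ∈ Set.Icc 0 T) (hσ : |σ| ≤ κ * h) (hβ : |β| ≤ κ * h) :
    q (U σ (Q y) - substepTarget U Q V (u t) (τ + σ) β) ≤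
      q (y - substepTarget U Q V (u t) τ β) + κ * h * η := by
  have hdecomp : U σ (Q y) - substepTarget U Q V (u t) (τ + σ) β =
      U σ (Q (y - substepTarget U Q V (u t) τ β)) + β • (U σ (Q (V (u t))) - V (u t)) := by
    simp only [substepTarget, map_sub, map_add, ContinuousLinearMap.map_smul_of_tower, smul_sub]
    rw [hQ.apply_trunc τ, hQ.trunc_trunc, ← hQ.apply_trunc τ, hQ.apply_apply σ τ, add_comm σ τ]
    abel
  rw [hdecomp]
  refine (map_add_le_add q _ _).trans (add_le_add ?_ ?_)
  · rw [hc.seminorm_apply]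
    exact hc.seminorm_trunc_le _
  · rw [map_smul_eq_mul, Real.norm_eq_abs]
    exact mul_le_mul hβ (hc.field_le t ht σ hσ) (apply_nonneg q _) ((abs_nonneg _).trans hβ)

theorem seminorm_sub_curve_le (hc : SplittingConsistency q U Q V u T h δ κ η) (hδ : 0 ≤ δ)
    (ht : t ∈ Set.Icc 0 T) (hτ : |τ| ≤ κ * h) (hβ : |β| ≤ κ * h) :
    q (w - u t) ≤ q (w - substepTarget U Q V (u t) τ β) + κ * h * κ + η := by
  have hdecomp : w - u t = (w - substepTarget U Q V (u t) τ β) + β • V (u t) +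
      (U τ (Q (u t)) - u t) := by
    rw [substepTarget]
    abel
  have hfield := hc.isLipschitzTube.seminorm_le _ ⟨t, ht, rfl⟩ _ (Metric.mem_closedBall_self hδ)
  rw [hdecomp]
  refine (map_add_le_add q _ _).trans (add_le_add ((map_add_le_add q _ _).trans ?_)
    (hc.curve_le t ht τ hτ))
  gcongr
  rw [map_smul_eq_mul, Real.norm_eq_abs]
  exact mul_le_mul hβ hfield (apply_nonneg q _) ((abs_nonneg _).trans hβ)

theorem seminorm_linear_sub_curve_le (hc : SplittingConsistency q U Q V u T h δ κ η)
    (hQ : IsTruncatedGroup U Q) (hδ : 0 ≤ δ) (hκ : 1 ≤ κ) (hh : 0 ≤ h) (hh1 : h ≤ 1)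
    (ht : t ∈ Set.Icc 0 T) (hσ : |σ| ≤ κ * h) (hτσ : |τ + σ| ≤ κ * h) (hβ : |β| ≤ κ * h) :
    q (U σ (Q y) - u t) ≤ 2 * κ ^ 2 * (q (y - substepTarget U Q V (u t) τ β) + η + h) := by
  have hη := hc.nonneg (by positivity) ht
  have hκ2 : κ ≤ κ ^ 2 := le_self_pow₀ hκ two_ne_zero
  have herr := apply_nonneg q (y - substepTarget U Q V (u t) τ β)
  have herr' := le_mul_of_one_le_left herr (show 1 ≤ 2 * κ ^ 2 by linarith)
  have hη' : η ≤ κ ^ 2 * η := le_mul_of_one_le_left hη (by linarith)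
  have hκη : κ * h * η ≤ κ ^ 2 * η := by
    gcongr
    exact (mul_le_of_le_one_right (by linarith) hh1).trans hκ2
  have hstep : 0 ≤ κ ^ 2 * h := by positivity
  linarith [hc.seminorm_linear_sub_le (y := y) (τ := τ) hQ ht hσ hβ,
    hc.seminorm_sub_curve_le (w := U σ (Q y)) hδ ht hτσ hβ]

theorem seminorm_nonlinear_sub_le (hc : SplittingConsistency q U Q V u T h δ κ η) (hδ : 0 ≤ δ)
    (hκ : 0 ≤ κ) (ht : t ∈ Set.Icc 0 T) (hτ : |τ| ≤ κ * h) (hβ : |β| ≤ κ * h) (hb : |b| ≤ κ * h)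
    (hw : ‖w - u t‖ ≤ δ) (hy' : ‖y' - w - b • V w‖ ≤ κ ^ 2 * b ^ 2) :
    q (y' - substepTarget U Q V (u t) τ (β + b)) ≤
      q (w - substepTarget U Q V (u t) τ β) + κ * (κ ^ 2 * (κ * h) ^ 2) +
        κ * h * (κ * (q (w - substepTarget U Q V (u t) τ β) + κ * h * κ + η)) := by
  have hdecomp : y' - substepTarget U Q V (u t) τ (β + b) =
      (w - substepTarget U Q V (u t) τ β) + (y' - w - b • V w) + b • (V w - V (u t)) := by
    simp only [substepTarget, add_smul, smul_sub]
    abel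
  have hflow : q (y' - w - b • V w) ≤ κ * (κ ^ 2 * (κ * h) ^ 2) := by
    refine (hc.seminorm_le _).trans (mul_le_mul_of_nonneg_left (hy'.trans ?_) hκ)
    rw [← sq_abs b]
    gcongr
  have hfield : q (V w - V (u t)) ≤ κ * q (w - u t) :=
    hc.isLipschitzTube.seminorm_sub_le _ ⟨t, ht, rfl⟩ w (by rwa [mem_closedBall_iff_norm]) _
      (Metric.mem_closedBall_self hδ)
  rw [hdecomp]
  refine (map_add_le_add q _ _).trans (add_le_add ((map_add_le_add q _ _).trans ?_) ?_)
  · gcongr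
  · rw [map_smul_eq_mul, Real.norm_eq_abs]
    refine mul_le_mul hb (hfield.trans ?_) (apply_nonneg q _) ((abs_nonneg _).trans hb)
    gcongr
    exact hc.seminorm_sub_curve_le hδ ht hτ hβ

end SplittingConsistency

/-- The factor by which one substep of size `h` amplifies the error. -/
noncomputable def substepGain (κ h : ℝ) : ℝ :=
  1 + 3 * κ ^ 5 * h

theorem substep_error_le {e : ℝ} (he : 0 ≤ e) (hη : 0 ≤ η) (hκ : 1 ≤ κ) (hh : 0 ≤ h)
    (hh1 : h ≤ 1) :
    e + κ * h * η + κ * (κ ^ 2 * (κ * h) ^ 2) +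
        κ * h * (κ * (e + κ * h * η + κ * h * κ + η)) + η + h ≤
      substepGain κ h * (e + η + h) := by
  have hpow : ∀ k ≤ 5, κ ^ k ≤ κ ^ 5 := fun k hk => pow_le_pow_right₀ hκ hk
  have he_coeff : κ ^ 2 * (h * e) ≤ 3 * κ ^ 5 * (h * e) := by
    gcongr; linarith [hpow 2 (by norm_num), hpow 0 (by norm_num)]
  have hη_coeff : (κ + κ ^ 2 + κ ^ 3 * h) * (h * η) ≤ 3 * κ ^ 5 * (h * η) := by
    have : κ ^ 3 * h ≤ κ ^ 3 := mul_le_of_le_one_right (by positivity) hh1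
    gcongr; linarith [hpow 1 (by norm_num), hpow 2 (by norm_num), hpow 3 (by norm_num)]
  have hh_coeff : (κ ^ 4 + κ ^ 5) * (h * h) ≤ 3 * κ ^ 5 * (h * h) := by
    gcongr; linarith [hpow 4 (by norm_num), hpow 0 (by norm_num)]
  rw [substepGain]
  linarith

theorem one_le_substepGain (hκ : 0 ≤ κ) (hh : 0 ≤ h) : 1 ≤ substepGain κ h :=
  le_add_of_nonneg_right (by positivity)

theorem substepGain_pow_le_exp (hκ : 0 ≤ κ) (hh : 0 ≤ h) {p : ℕ} (hp : p * h ≤ T) :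
    substepGain κ h ^ p ≤ Real.exp (3 * κ ^ 5 * T) := by
  calc substepGain κ h ^ p ≤ Real.exp (3 * κ ^ 5 * h) ^ p := by
        gcongr
        · exact zero_le_one.trans (one_le_substepGain hκ hh)
        · rw [substepGain, add_comm]
          exact Real.add_one_le_exp _
    _ = Real.exp (3 * κ ^ 5 * (p * h)) := by rw [← Real.exp_nat_mul]; ring_nf
    _ ≤ Real.exp (3 * κ ^ 5 * T) := by gcongr

namespace IsSplittingPair

variable {ΨA ΦB : ℝ → H → Part H}

theorem exists_mem_substep (hp : IsSplittingPair U Q V u ΨA ΦB T h δ κ)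
    (h₁ : SplittingConsistency (normSeminorm ℝ H) U Q V u T h δ κ η₁) (hκ : 1 ≤ κ) (hh : 0 ≤ h)
    (hh1 : h ≤ 1) {t τ σ β b : ℝ} (ht : t ∈ Set.Icc 0 T) (hσ : |σ| ≤ κ * h)
    (hτσ : |τ + σ| ≤ κ * h) (hβ : |β| ≤ κ * h) (hb : |b| ≤ κ * h) {y : H}
    (hy : 2 * κ ^ 2 * (‖y - substepTarget U Q V (u t) τ β‖ + η₁ + h) ≤ δ / 2) :
    ∃ y' ∈ ((Part.some y).bind (ΨA σ)).bind (ΦB b),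
      ∀ (q : Seminorm ℝ H) (η : ℝ), SplittingConsistency q U Q V u T h δ κ η →
        q (y' - substepTarget U Q V (u t) (τ + σ) (β + b)) + η + h ≤
          substepGain κ h * (q (y - substepTarget U Q V (u t) τ β) + η + h) := by
  have hδ : 0 ≤ δ := by
    have := h₁.nonneg (by positivity) ht
    have : 0 ≤ 2 * κ ^ 2 * (‖y - substepTarget U Q V (u t) τ β‖ + η₁ + h) := by positivity
    linarith
  have htube : ‖U σ (Q y) - u t‖ ≤ δ / 2 :=
    (h₁.seminorm_linear_sub_curve_le hp.isTruncatedGroup hδ hκ hh hh1 ht hσ hτσ hβ).trans hy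
  obtain ⟨y', hy', herr⟩ := hp.exists_mem_flow t ht _ htube b hb
  refine ⟨y', ?_, fun q η hc => ?_⟩
  · rw [Part.bind_some, Part.eq_some_iff.2 (hp.apply_trunc_mem σ y), Part.bind_some]
    exact hy'
  · have hlinear := hc.seminorm_linear_sub_le (y := y) (τ := τ) hp.isTruncatedGroup ht hσ hβ
    have hnonlinear := hc.seminorm_nonlinear_sub_le hδ (by linarith) ht hτσ hβ hb
      (htube.trans (by linarith)) herr
    refine le_trans ?_ (substep_error_le (apply_nonneg q _) (hc.nonneg (by positivity) ht)
      hκ hh hh1)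
    refine (add_le_add_left (add_le_add_left hnonlinear η) h).trans ?_
    gcongr

theorem exists_mem_foldl (hp : IsSplittingPair U Q V u ΨA ΦB T h δ κ)
    (h₁ : SplittingConsistency (normSeminorm ℝ H) U Q V u T h δ κ η₁) (hκ : 1 ≤ κ) (hh : 0 ≤ h)
    (hh1 : h ≤ 1) {t : ℝ} (ht : t ∈ Set.Icc 0 T) {J : Type*} (a b : J → ℝ) (l : List J) :
    ∀ (y : H) (τ β : ℝ), |τ| + (l.map fun j => |a j * h|).sum ≤ κ * h →
      |β| + (l.map fun j => |b j * h|).sum ≤ κ * h →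
      2 * κ ^ 2 * (substepGain κ h ^ l.length *
        (‖y - substepTarget U Q V (u t) τ β‖ + η₁ + h)) ≤ δ / 2 →
      ∃ y' ∈ l.foldl (fun y j => (y.bind (ΨA (a j * h))).bind (ΦB (b j * h))) (Part.some y),
        ∀ (q : Seminorm ℝ H) (η : ℝ), SplittingConsistency q U Q V u T h δ κ η →
          q (y' - substepTarget U Q V (u t) (τ + (l.map fun j => a j * h).sum)
              (β + (l.map fun j => b j * h).sum)) + η + h ≤
            substepGain κ h ^ l.length * (q (y - substepTarget U Q V (u t) τ β) + η + h) := by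
  have hgain := one_le_substepGain (show 0 ≤ κ by linarith) hh
  induction l with
  | nil => exact fun y τ β _ _ _ => ⟨y, Part.mem_some y, fun q η _ => by simp⟩
  | cons j l ih =>
    intro y τ β hτ hβ hy
    simp only [List.map_cons, List.sum_cons, List.length_cons, ← add_assoc] at hτ hβ hy ⊢
    have hrest : ∀ c : J → ℝ, 0 ≤ (l.map fun j => |c j * h|).sum := fun c =>
      List.sum_nonneg (List.forall_mem_map.2 fun _ _ => abs_nonneg _)
    have hτ_rest := hrest a
    have hβ_rest := hrest b
    have hτ_add := abs_add_le τ (a j * h)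
    have hβ_add := abs_add_le β (b j * h)
    have hsubstep : 2 * κ ^ 2 * (‖y - substepTarget U Q V (u t) τ β‖ + η₁ + h) ≤ δ / 2 := by
      have := h₁.nonneg (by positivity) ht
      refine le_trans ?_ hy
      gcongr
      exact le_mul_of_one_le_left (by positivity) (one_le_pow₀ hgain)
    obtain ⟨y', hy', herr⟩ := hp.exists_mem_substep h₁ hκ hh hh1 ht (τ := τ)
      (σ := a j * h) (β := β) (b := b j * h) (by linarith [abs_nonneg τ]) (by linarith)
      (by linarith [abs_nonneg (b j * h)]) (by linarith [abs_nonneg β]) hsubstep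
    obtain ⟨y'', hy'', herr'⟩ := ih y' (τ + a j * h) (β + b j * h) (by linarith) (by linarith) (by
      refine le_trans ?_ hy
      rw [pow_succ (substepGain κ h), mul_assoc (substepGain κ h ^ _)]
      gcongr
      exact herr _ _ h₁)
    refine ⟨y'', by rwa [List.foldl_cons, Part.eq_some_iff.2 hy'], fun q η hc => ?_⟩
    refine (herr' q η hc).trans ?_
    rw [pow_succ (substepGain κ h), mul_assoc (substepGain κ h ^ _)]
    gcongr
    exact herr q η hc

theorem exists_mem_splittingStep (hp : IsSplittingPair U Q V u ΨA ΦB T h δ κ)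
    (h₁ : SplittingConsistency (normSeminorm ℝ H) U Q V u T h δ κ η₁) (hκ : 1 ≤ κ) (hh : 0 ≤ h)
    (hh1 : h ≤ 1) {m : ℕ} {a b : Fin m → ℝ} (ha : ∑ j, a j = 1) (hb : ∑ j, b j = 1)
    (haκ : ∑ j, |a j| ≤ κ) (hbκ : ∑ j, |b j| ≤ κ) {t : ℝ} (ht : t ∈ Set.Icc 0 T)
    (hth : t + h ∈ Set.Icc 0 T) {v : H}
    (hv : 2 * κ ^ 2 * (substepGain κ h ^ m * (‖v - Q (u t)‖ + η₁ + h)) ≤ δ / 2) :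
    ∃ v' ∈ splittingStep ΨA ΦB a b h v,
      ∀ (q : Seminorm ℝ H) (η : ℝ), SplittingConsistency q U Q V u T h δ κ η →
        q (v' - Q (u (t + h))) + η + h ≤
          substepGain κ h ^ (m + 1) * (q (v - Q (u t)) + η + h) := by
  have hstart : substepTarget U Q V (u t) 0 0 = Q (u t) := by
    rw [substepTarget, hp.isTruncatedGroup.zero_apply, zero_smul, add_zero]
  have habs : ∀ {c : Fin m → ℝ}, ∑ j, |c j| ≤ κ →
      |(0 : ℝ)| + ((List.finRange m).map fun j => |c j * h|).sum ≤ κ * h := fun hc => by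
    simp only [abs_mul, abs_of_nonneg hh, abs_zero, zero_add, ← Fin.sum_univ_def,
      ← Finset.sum_mul]
    gcongr
  have hsum : ∀ {c : Fin m → ℝ}, ∑ j, c j = 1 →
      0 + ((List.finRange m).map fun j => c j * h).sum = h := fun hc => by
    rw [← Fin.sum_univ_def, ← Finset.sum_mul, hc, one_mul, zero_add]
  obtain ⟨v', hv', herr⟩ := hp.exists_mem_foldl h₁ hκ hh hh1 ht a b (List.finRange m) v 0 0
    (habs haκ) (habs hbκ) (by rwa [hstart, List.length_finRange])
  refine ⟨v', hv', fun q η hc => ?_⟩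
  have hη := hc.nonneg (by positivity) ht
  have hfold := herr q η hc
  rw [hsum ha, hsum hb, hstart, List.length_finRange] at hfold
  have hquad : q (v' - Q (u (t + h))) ≤ q (v' - substepTarget U Q V (u t) h h) + h * η := by
    rw [← sub_sub_sub_cancel_right _ _ (substepTarget U Q V (u t) h h)]
    exact (map_sub_le_add q _ _).trans (by gcongr; exact hc.step_le t ht hth)
  set e := q (v' - substepTarget U Q V (u t) h h)
  have he : 0 ≤ e := apply_nonneg q _
  calc q (v' - Q (u (t + h))) + η + h ≤ e + η + h + 1 * h * η := by linarith
    _ ≤ e + η + h + 3 * κ ^ 5 * h * (e + η + h) := by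
        gcongr
        · linarith [one_le_pow₀ hκ (n := 5)]
        · linarith
    _ = substepGain κ h * (e + η + h) := by rw [substepGain]; ring
    _ ≤ substepGain κ h * (substepGain κ h ^ m * (q (v - Q (u t)) + η + h)) := by
        gcongr
        exact zero_le_one.trans (one_le_substepGain (by linarith) hh)
    _ = _ := by rw [pow_succ (substepGain κ h)]; ring

theorem exists_mem_partialIterate (hp : IsSplittingPair U Q V u ΨA ΦB T h δ κ)
    (h₁ : SplittingConsistency (normSeminorm ℝ H) U Q V u T h δ κ η₁) (hκ : 1 ≤ κ) (hh : 0 ≤ h)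
    (hh1 : h ≤ 1) {m : ℕ} {a b : Fin m → ℝ} (ha : ∑ j, a j = 1) (hb : ∑ j, b j = 1)
    (haκ : ∑ j, |a j| ≤ κ) (hbκ : ∑ j, |b j| ≤ κ)
    (htube : 2 * κ ^ 2 * (Real.exp (3 * κ ^ 5 * ((m + 1) * T)) * (2 * η₁ + h)) ≤ δ / 2) (k : ℕ)
    (hk : k * h ≤ T) :
    ∃ v ∈ partialIterate (splittingStep ΨA ΦB a b h) k (u 0),
      ∀ (q : Seminorm ℝ H) (η : ℝ), SplittingConsistency q U Q V u T h δ κ η →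
        q (v - Q (u (k * h))) + η + h ≤ substepGain κ h ^ (k * (m + 1)) * (2 * η + h) := by
  have hκ0 : 0 ≤ κ := by linarith
  have hgain := one_le_substepGain hκ0 hh
  induction k with
  | zero =>
    refine ⟨u 0, Part.mem_some _, fun q η hc => ?_⟩
    have hinit := hc.curve_le 0 ⟨le_rfl, by simpa using hk⟩ 0 (by rw [abs_zero]; positivity)
    rw [hp.isTruncatedGroup.zero_apply, map_sub_rev] at hinit
    simp only [Nat.cast_zero, zero_mul, pow_zero, one_mul]
    linarith
  | succ k ih =>
    have hkh : ((k + 1 : ℕ) : ℝ) * h = k * h + h := by push_cast; ring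
    rw [hkh] at hk ⊢
    obtain ⟨v, hv, herr⟩ := ih (by linarith)
    have ht : k * h ∈ Set.Icc 0 T := ⟨by positivity, by linarith⟩
    have hη₁ := h₁.nonneg (by positivity) ht
    have hexp : substepGain κ h ^ m * substepGain κ h ^ (k * (m + 1)) ≤
        Real.exp (3 * κ ^ 5 * ((m + 1) * T)) := by
      rw [← pow_add]
      refine substepGain_pow_le_exp hκ0 hh ?_
      push_cast
      nlinarith
    obtain ⟨v', hv', herr'⟩ := hp.exists_mem_splittingStep h₁ hκ hh hh1 ha hb haκ hbκ ht
      ⟨by positivity, hk⟩ (v := v) (by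
        refine (mul_le_mul_of_nonneg_left ?_ (by positivity)).trans htube
        calc substepGain κ h ^ m * (‖v - Q (u (k * h))‖ + η₁ + h)
            ≤ substepGain κ h ^ m * (substepGain κ h ^ (k * (m + 1)) * (2 * η₁ + h)) := by
              gcongr
              exact herr _ _ h₁
          _ ≤ Real.exp (3 * κ ^ 5 * ((m + 1) * T)) * (2 * η₁ + h) := by
              rw [← mul_assoc]
              gcongr)
    refine ⟨v', Part.mem_bind hv hv', fun q η hc => (herr' q η hc).trans ?_⟩
    rw [add_one_mul k, add_comm (k * (m + 1)), pow_add _ (m + 1), mul_assoc]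
    gcongr
    exact herr q η hc

theorem exists_mem_partialIterate_seminorm_sub_le (hp : IsSplittingPair U Q V u ΨA ΦB T h δ κ)
    (h₁ : SplittingConsistency (normSeminorm ℝ H) U Q V u T h δ κ η₁)
    (hq : SplittingConsistency q U Q V u T h δ κ η) (hκ : 1 ≤ κ) (hh : 0 ≤ h) (hh1 : h ≤ 1)
    {m : ℕ} {a b : Fin m → ℝ} (ha : ∑ j, a j = 1) (hb : ∑ j, b j = 1) (haκ : ∑ j, |a j| ≤ κ)
    (hbκ : ∑ j, |b j| ≤ κ)
    (htube : 2 * κ ^ 2 * (Real.exp (3 * κ ^ 5 * ((m + 1) * T)) * (2 * η₁ + h)) ≤ δ / 2) (k : ℕ)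
    (hk : k * h ≤ T) :
    ∃ v ∈ partialIterate (splittingStep ΨA ΦB a b h) k (u 0),
      q (u (k * h) - v) ≤ Real.exp (3 * κ ^ 5 * ((m + 1) * T)) * (2 * η + h) := by
  have hκ0 : 0 ≤ κ := by linarith
  obtain ⟨v, hv, herr⟩ :=
    hp.exists_mem_partialIterate h₁ hκ hh hh1 ha hb haκ hbκ htube k hk
  have ht : k * h ∈ Set.Icc 0 T := ⟨by positivity, hk⟩
  have hη := hq.nonneg (by positivity) ht
  have htrunc := hq.curve_le _ ht 0 (by rw [abs_zero]; positivity)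
  rw [hp.isTruncatedGroup.zero_apply] at htrunc
  have hexp : substepGain κ h ^ (k * (m + 1)) ≤ Real.exp (3 * κ ^ 5 * ((m + 1) * T)) := by
    refine substepGain_pow_le_exp hκ0 hh ?_
    push_cast
    nlinarith
  refine ⟨v, hv, ?_⟩
  calc q (u (k * h) - v) = q ((v - Q (u (k * h))) + (Q (u (k * h)) - u (k * h))) := by
        rw [sub_add_sub_cancel, map_sub_rev]
    _ ≤ q (v - Q (u (k * h))) + η := (map_add_le_add q _ _).trans (by gcongr)
    _ ≤ substepGain κ h ^ (k * (m + 1)) * (2 * η + h) := by linarith [herr q η hq]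
    _ ≤ Real.exp (3 * κ ^ 5 * ((m + 1) * T)) * (2 * η + h) := by gcongr

end IsSplittingPair

end SplittingError

/-! ### Consistency and convergence -/

section Consistency

variable {H X : Type*} [NormedAddCommGroup H] [InnerProductSpace ℂ H] [NormedAddCommGroup X]
  [InnerProductSpace ℂ X] {J : H →L[ℂ] X} {U : ℝ → H →L[ℂ] H} {V : H → H} {u : ℝ → H}
  {T h C R δ κ η : ℝ}

/-- The curve `u` is a mild solution on `[0, T]` of `u' = Gu + V(u)`, where `G` generates `U`: it
satisfies the variation of constants formula between any two times. -/
structure IsMildSolution (U : ℝ → H →L[ℂ] H) (V : H → H) (T : ℝ) (u : ℝ → H) : Prop where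
  continuousOn : ContinuousOn u (Set.Icc 0 T)
  eq_add_integral : ∀ s ∈ Set.Icc 0 T, ∀ t ∈ Set.Icc 0 T,
    u t = U (t - s) (u s) + ∫ r in s..t, U (t - r) (V (u r))

theorem IsDuhamelSolution.isMildSolution [CompleteSpace H] {A : H →ₗ.[ℂ] H} {B : H → H} {u₀ : H}
    (h : IsDuhamelSolution U B u₀ T u) (hU : IsUnitaryGroupGeneratedBy A U) (hB : Continuous B) :
    IsMildSolution U (fun x => -(Complex.I • B x)) T u :=
  ⟨h.1, fun _ hs _ ht => h.eq_add_integral hU hB hs ht⟩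

theorem tendsto_sq_inv_nhdsGT_zero : Tendsto (fun h : ℝ => (h ^ 2)⁻¹) (𝓝[>] 0) atTop := by
  simpa only [Function.comp_def, inv_pow] using
    (tendsto_pow_atTop (α := ℝ) two_ne_zero).comp tendsto_inv_nhdsGT_zero

theorem eventually_mul_lt_nhdsGT_zero (r : ℝ) {ε : ℝ} (hε : 0 < ε) :
    ∀ᶠ h in 𝓝[>] (0 : ℝ), r * h < ε :=
  (((continuous_const_mul r).tendsto' 0 0 (mul_zero r)).mono_left
    nhdsWithin_le_nhds).eventually (gt_mem_nhds hε)

theorem eventually_forall_abs_le_mul {P : ℝ × ℝ → Prop} (hP : ∀ᶠ p in 𝓝 0 ×ˢ atTop, P p) (κ : ℝ) :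
    ∀ᶠ h in 𝓝[>] (0 : ℝ), ∀ R, (h ^ 2)⁻¹ < R → ∀ τ, |τ| ≤ κ * h → P (τ, R) := by
  obtain ⟨p, hp, q, hq, hpq⟩ := eventually_prod_iff.1 hP
  obtain ⟨ρ, hρ, hρp⟩ := Metric.eventually_nhds_iff.1 hp
  obtain ⟨R₀, hR₀⟩ := eventually_atTop.1 hq
  filter_upwards [eventually_mul_lt_nhdsGT_zero κ hρ,
    tendsto_sq_inv_nhdsGT_zero.eventually (eventually_ge_atTop R₀)] with h hh hhR R hR τ hτ
  refine hpq (hρp ?_) (hR₀ R (hhR.trans hR.le))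
  rw [Real.dist_0_eq_abs]
  exact hτ.trans_lt hh

theorem exists_forall_div_natCast {P : ℝ → Prop} (hT : 0 < T) (hP : ∀ᶠ h in 𝓝[>] 0, P h) :
    ∃ n₀ : ℕ, 0 < n₀ ∧ ∀ n : ℕ, n₀ ≤ n → P (T / n) := by
  have hdiv : Tendsto (fun n : ℕ => T / n) atTop (𝓝[>] 0) :=
    tendsto_nhdsWithin_iff.2 ⟨tendsto_const_div_atTop_nhds_zero_nat T, by
      filter_upwards [eventually_gt_atTop 0] with n hn
      exact div_pos hT (Nat.cast_pos.2 hn)⟩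
  obtain ⟨n₀, hn₀⟩ := eventually_atTop.1 (hdiv.eventually hP)
  exact ⟨n₀ + 1, n₀.succ_pos, fun n hn => hn₀ n (Nat.le_of_succ_le hn)⟩

theorem eventually_forall_norm_sub_le {F : Type*} [NormedAddCommGroup F] {f : ℝ → F}
    (hf : ContinuousOn f (Set.Icc 0 T)) {ε : ℝ} (hε : 0 < ε) :
    ∀ᶠ h in 𝓝[>] (0 : ℝ), ∀ s ∈ Set.Icc 0 T, ∀ t ∈ Set.Icc 0 T, |s - t| ≤ h →
      ‖f s - f t‖ ≤ ε := by
  obtain ⟨ρ, hρ, hf⟩ := Metric.uniformContinuousOn_iff_le.1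
    (isCompact_Icc.uniformContinuousOn_of_continuous hf) ε hε
  filter_upwards [mem_nhdsWithin_of_mem_nhds (gt_mem_nhds hρ)] with h hh s hs t ht hst
  rw [← dist_eq_norm]
  exact hf s hs t ht (hst.trans hh.le)

theorem pullbackNorm_id : pullbackNorm (.id ℂ H) = normSeminorm ℝ H :=
  rfl

theorem eventually_isLipschitzTube (hV : LocallyLipschitzFor (pullbackNorm J) V)
    (hVc : Continuous V) {K : Set H} (hK : IsCompact K) :
    ∀ᶠ δ in 𝓝[>] (0 : ℝ), ∀ᶠ κ in atTop, IsLipschitzTube (pullbackNorm J) V K δ κ := by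
  obtain ⟨δ₀, hδ₀, L, hL⟩ := hV.exists_forall_closedBall hK
  obtain ⟨M, hM⟩ := hK.exists_bound_of_continuousOn hVc.continuousOn
  filter_upwards [mem_nhdsWithin_of_mem_nhds (Iic_mem_nhds hδ₀)] with δ hδ
  filter_upwards [eventually_ge_atTop (L : ℝ), eventually_ge_atTop (L * (‖J‖ * δ₀) + ‖J‖ * M)]
    with κ hLκ hMκ
  have hsub (x : H) := Metric.closedBall_subset_closedBall (x := x) hδ
  refine ⟨fun x hx y hy z hz => (hL x hx y (hsub x hy) z (hsub x hz)).trans ?_,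
    fun x hx y hy => le_trans ?_ hMκ⟩
  · gcongr
  · have hdiff := hL x hx y (hsub x hy) x (Metric.mem_closedBall_self hδ₀.le)
    simp only [pullbackNorm_apply] at hdiff ⊢
    calc ‖J (V y)‖ ≤ ‖J (V y - V x)‖ + ‖J (V x)‖ := by
          rw [map_sub]
          exact norm_le_norm_sub_add _ _
      _ ≤ L * (‖J‖ * δ₀) + ‖J‖ * M :=
          add_le_add (hdiff.trans (mul_le_mul_of_nonneg_left
            (J.le_opNorm_of_le (mem_closedBall_iff_norm.1 (hsub x hy))) L.2))
            (J.le_opNorm_of_le (hM x hx))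

namespace IsMildSolution

theorem continuousOn_apply (hu : IsMildSolution U V T u) (hV : Continuous V)
    (hU : Continuous fun p : ℝ × H => U p.1 p.2) (t : ℝ) :
    ContinuousOn (fun r => U (t - r) (V (u r))) (Set.Icc 0 T) :=
  hU.comp_continuousOn ((continuousOn_const.sub continuousOn_id).prodMk
    (hV.comp_continuousOn hu.continuousOn))

theorem isCompact_image (hu : IsMildSolution U V T u) : IsCompact (u '' Set.Icc 0 T) :=
  isCompact_Icc.image_of_continuousOn hu.continuousOn

variable {Q : H →L[ℂ] H} [CompleteSpace H]

theorem trunc_sub_substepTarget_eq (hu : IsMildSolution U V T u) (hV : Continuous V)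
    (hU : Continuous fun p : ℝ × H => U p.1 p.2) (hQ : IsTruncatedGroup U Q) {t : ℝ}
    (ht : t ∈ Set.Icc 0 T) (hth : t + h ∈ Set.Icc 0 T) :
    Q (u (t + h)) - substepTarget U Q V (u t) h h =
      ∫ r in t..(t + h), (U (t + h - r) (Q (V (u r))) - V (u t)) := by
  have hcont := (hu.continuousOn_apply hV hU (t + h)).mono
    (Set.ordConnected_Icc.uIcc_subset ht hth)
  have hQcont : ContinuousOn (fun r => Q (U (t + h - r) (V (u r)))) (Set.uIcc t (t + h)) :=
    Q.continuous.comp_continuousOn hcont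
  simp only [hQ.apply_trunc]
  rw [intervalIntegral.integral_sub hQcont.intervalIntegrable
      intervalIntegrable_const, intervalIntegral.integral_const, add_sub_cancel_left,
    ContinuousLinearMap.intervalIntegral_comp_comm _ hcont.intervalIntegrable,
    hu.eq_add_integral t ht _ hth, map_add, add_sub_cancel_left, substepTarget, hQ.apply_trunc]
  abel

theorem norm_map_trunc_sub_substepTarget_le [CompleteSpace X] (hu : IsMildSolution U V T u)
    (hV : Continuous V) (hU : Continuous fun p : ℝ × H => U p.1 p.2) (hQ : IsTruncatedGroup U Q)
    (hh : 0 ≤ h)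
    (hfield : ∀ t ∈ Set.Icc 0 T, ∀ τ, |τ| ≤ h → ‖J (U τ (Q (V (u t))) - V (u t))‖ ≤ η / 2)
    (hosc : ∀ s ∈ Set.Icc 0 T, ∀ t ∈ Set.Icc 0 T, |s - t| ≤ h → ‖J (V (u s) - V (u t))‖ ≤ η / 2)
    {t : ℝ} (ht : t ∈ Set.Icc 0 T) (hth : t + h ∈ Set.Icc 0 T) :
    ‖J (Q (u (t + h)) - substepTarget U Q V (u t) h h)‖ ≤ h * η := by
  have hcont : ContinuousOn (fun r => U (t + h - r) (Q (V (u r))) - V (u t))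
      (Set.uIcc t (t + h)) := by
    simp only [hQ.apply_trunc]
    exact (Q.continuous.comp_continuousOn ((hu.continuousOn_apply hV hU (t + h)).mono
      (Set.ordConnected_Icc.uIcc_subset ht hth))).sub continuousOn_const
  have hintegrand : ∀ r ∈ Set.uIoc t (t + h),
      ‖J (U (t + h - r) (Q (V (u r))) - V (u t))‖ ≤ η := fun r hr => by
    rw [Set.uIoc_of_le (by linarith)] at hr
    have hr' : r ∈ Set.Icc 0 T := ⟨ht.1.trans hr.1.le, hr.2.trans hth.2⟩
    have htime := hfield r hr' (t + h - r) (by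
      rw [abs_of_nonneg (by linarith [hr.2])]
      linarith [hr.1])
    have hspace := hosc r hr' t ht (by
      rw [abs_of_nonneg (by linarith [hr.1])]
      linarith [hr.2])
    rw [← sub_add_sub_cancel _ (V (u r)), map_add]
    exact (norm_add_le _ _).trans (by linarith)
  rw [hu.trunc_sub_substepTarget_eq hV hU hQ ht hth,
    ← ContinuousLinearMap.intervalIntegral_comp_comm _ hcont.intervalIntegrable]
  refine (intervalIntegral.norm_integral_le_of_norm_le_const hintegrand).trans_eq ?_
  rw [add_sub_cancel_left, abs_of_nonneg hh, mul_comm]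

theorem splittingConsistency [CompleteSpace X] (hu : IsMildSolution U V T u) (hV : Continuous V)
    (hU : Continuous fun p : ℝ × H => U p.1 p.2) (hQ : IsTruncatedGroup U Q)
    (hJU : ∀ t x, ‖J (U t x)‖ = ‖J x‖) (hJQ : ∀ x, ‖J (Q x)‖ ≤ ‖J x‖) (hJκ : ‖J‖ ≤ κ)
    (hκ : 1 ≤ κ) (hh : 0 ≤ h) (hη : 0 ≤ η)
    (htube : IsLipschitzTube (pullbackNorm J) V (u '' Set.Icc 0 T) δ κ)
    (happrox : ∀ τ, |τ| ≤ κ * h → ∀ x ∈ u '' Set.Icc 0 T ∪ V '' (u '' Set.Icc 0 T),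
      ‖J (U τ (Q x) - x)‖ ≤ η / 2)
    (hosc : ∀ s ∈ Set.Icc 0 T, ∀ t ∈ Set.Icc 0 T, |s - t| ≤ h → ‖J (V (u s) - V (u t))‖ ≤ η / 2) :
    SplittingConsistency (pullbackNorm J) U Q V u T h δ κ η := by
  have hfield : ∀ t ∈ Set.Icc 0 T, ∀ τ, |τ| ≤ κ * h → ‖J (U τ (Q (V (u t))) - V (u t))‖ ≤ η / 2 :=
    fun t ht τ hτ => happrox τ hτ _ (.inr ⟨_, ⟨t, ht, rfl⟩, rfl⟩)
  exact
    { seminorm_le := fun y => J.le_of_opNorm_le hJκ y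
      seminorm_apply := hJU
      seminorm_trunc_le := hJQ
      isLipschitzTube := htube
      curve_le := fun t ht τ hτ => (happrox τ hτ _ (.inl ⟨t, ht, rfl⟩)).trans (half_le_self hη)
      field_le := fun t ht τ hτ => (hfield t ht τ hτ).trans (half_le_self hη)
      step_le := fun t ht hth => hu.norm_map_trunc_sub_substepTarget_le hV hU hQ hh
        (fun t ht τ hτ => hfield t ht τ (hτ.trans (le_mul_of_one_le_left hh hκ))) hosc ht hth }

end IsMildSolution

namespace IsSplittingFrame

variable {Q : ℝ → H →L[ℂ] H}

theorem tendsto_apply_trunc (hF : IsSplittingFrame J U Q C) (x : H) :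
    Tendsto (fun p : ℝ × ℝ => U p.1 (Q p.2 x)) (𝓝 0 ×ˢ atTop) (𝓝 x) := by
  have hpair : Tendsto (fun p : ℝ × ℝ => (p.1, Q p.2 x)) (𝓝 0 ×ˢ atTop) (𝓝 (0, x)) :=
    tendsto_fst.prodMk_nhds ((hF.tendsto_trunc x).comp tendsto_snd)
  simpa only [Function.comp_def, (hF.isTruncatedGroup 1 one_pos).zero_apply] using
    (hF.continuous_apply.tendsto (0, x)).comp hpair

theorem norm_apply_trunc_sub_le (hF : IsSplittingFrame J U Q C) (hR : 0 < R) (τ : ℝ) (x y : H) :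
    ‖U τ (Q R y) - y‖ ≤ ‖U τ (Q R x) - x‖ + 2 * ‖y - x‖ := by
  have hcontr : ‖U τ (Q R (y - x))‖ ≤ ‖y - x‖ :=
    (hF.norm_apply τ _).trans_le (hF.norm_trunc_le R hR _)
  have hdecomp : U τ (Q R y) - y = U τ (Q R x) - x + (U τ (Q R (y - x)) - (y - x)) := by
    simp only [map_sub]
    abel
  rw [hdecomp]
  linarith [norm_add_le (U τ (Q R x) - x) (U τ (Q R (y - x)) - (y - x)),
    norm_sub_le (U τ (Q R (y - x))) (y - x)]

theorem eventually_forall_norm_apply_trunc_sub_le (hF : IsSplittingFrame J U Q C) {K : Set H}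
    (hK : IsCompact K) {ε : ℝ} (hε : 0 < ε) :
    ∀ᶠ p : ℝ × ℝ in 𝓝 0 ×ˢ atTop, ∀ x ∈ K, ‖U p.1 (Q p.2 x) - x‖ ≤ ε := by
  refine hK.induction_on (p := fun K => ∀ᶠ p : ℝ × ℝ in 𝓝 0 ×ˢ atTop, ∀ x ∈ K,
    ‖U p.1 (Q p.2 x) - x‖ ≤ ε) (by simp)
    (fun s t hst ht => ht.mono fun p hp x hx => hp x (hst hx))
    (fun s t hs ht => (hs.and ht).mono fun p hp x hx => hx.elim (hp.1 x) (hp.2 x)) ?_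
  intro x _
  refine ⟨Metric.ball x (ε / 4), mem_nhdsWithin_of_mem_nhds (Metric.ball_mem_nhds x
    (by positivity)), ?_⟩
  filter_upwards [(hF.tendsto_apply_trunc x).eventually (Metric.ball_mem_nhds x (half_pos hε)),
    tendsto_snd.eventually (eventually_gt_atTop (0 : ℝ))] with p hp hR y hy
  rw [dist_eq_norm] at hp
  rw [mem_ball_iff_norm] at hy
  linarith [hF.norm_apply_trunc_sub_le hR p.1 x y]

theorem norm_map_apply_trunc_sub_le (hF : IsSplittingFrame J U Q C) (hh : 0 < h) (hh1 : h ≤ 1)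
    (hR : (h ^ 2)⁻¹ < R) {τ : ℝ} (hτ : |τ| ≤ κ * h) (x : H) :
    ‖J (U τ (Q R x) - x)‖ ≤ C * (1 + κ) * h * ‖x‖ := by
  have hC := hF.nonneg
  have hR0 : 0 < R := lt_trans (by positivity) hR
  have hCR : C / R ≤ C * h := by
    rw [div_eq_mul_inv]
    gcongr
    calc R⁻¹ ≤ h ^ 2 := inv_le_of_inv_le₀ (by positivity) hR.le
      _ ≤ h := pow_le_of_le_one hh.le hh1 two_ne_zero
  have hdecomp : U τ (Q R x) - x = U τ (Q R x - x) + (U τ x - x) := by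
    rw [map_sub]
    abel
  calc ‖J (U τ (Q R x) - x)‖ ≤ ‖J (Q R x - x)‖ + ‖J (U τ x - x)‖ := by
        rw [hdecomp, map_add, ← hF.norm_map_apply τ (Q R x - x)]
        exact norm_add_le _ _
    _ ≤ C / R * ‖x‖ + C * |τ| * ‖x‖ :=
        add_le_add (hF.norm_map_trunc_sub_le R hR0 x) (hF.norm_map_apply_sub_le τ x)
    _ ≤ C * h * ‖x‖ + C * (κ * h) * ‖x‖ := by gcongr
    _ = C * (1 + κ) * h * ‖x‖ := by ring

theorem norm_map_sub_le_of_isMildSolution (hF : IsSplittingFrame J U Q C)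
    (hu : IsMildSolution U V T u) {b : ℝ}
    (hb : ∀ x ∈ u '' Set.Icc 0 T ∪ V '' (u '' Set.Icc 0 T), ‖x‖ ≤ b) {s t : ℝ}
    (hs : s ∈ Set.Icc 0 T) (ht : t ∈ Set.Icc 0 T) :
    ‖J (u s - u t)‖ ≤ (C + ‖J‖) * b * |s - t| := by
  have hC := hF.nonneg
  have hincr : u s - u t = (U (s - t) (u t) - u t) + ∫ r in t..s, U (s - r) (V (u r)) := by
    conv_lhs => rw [hu.eq_add_integral t ht s hs]
    abel
  have hlinear : ‖J (U (s - t) (u t) - u t)‖ ≤ C * |s - t| * b :=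
    (hF.norm_map_apply_sub_le _ _).trans (by gcongr; exact hb _ (.inl ⟨t, ht, rfl⟩))
  have hintegral : ‖∫ r in t..s, U (s - r) (V (u r))‖ ≤ b * |s - t| :=
    intervalIntegral.norm_integral_le_of_norm_le_const fun r hr => by
      rw [hF.norm_apply]
      exact hb _ (.inr ⟨_, ⟨r, Set.ordConnected_Icc.uIcc_subset ht hs
        (Set.uIoc_subset_uIcc hr), rfl⟩, rfl⟩)
  rw [hincr, map_add]
  linarith [norm_add_le (J (U (s - t) (u t) - u t)) (J (∫ r in t..s, U (s - r) (V (u r)))),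
    J.le_opNorm_of_le hintegral]

variable [CompleteSpace H]

theorem eventually_splittingConsistency_normSeminorm (hF : IsSplittingFrame J U Q C)
    (hu : IsMildSolution U V T u) (hV : Continuous V) (hκ : 1 ≤ κ)
    (htube : IsLipschitzTube (normSeminorm ℝ H) V (u '' Set.Icc 0 T) δ κ) (hη : 0 < η) :
    ∀ᶠ h in 𝓝[>] (0 : ℝ), ∀ R, (h ^ 2)⁻¹ < R →
      SplittingConsistency (normSeminorm ℝ H) U (Q R) V u T h δ κ η := by
  have hK := hu.isCompact_image.union (hu.isCompact_image.image hV)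
  filter_upwards [self_mem_nhdsWithin, eventually_forall_abs_le_mul
    (hF.eventually_forall_norm_apply_trunc_sub_le hK (half_pos hη)) κ,
    eventually_forall_norm_sub_le (hV.comp_continuousOn hu.continuousOn) (half_pos hη)]
    with h hh happrox hosc R hR
  have hR0 : 0 < R := (inv_nonneg.2 (sq_nonneg h)).trans_lt hR
  rw [← pullbackNorm_id] at htube ⊢
  exact hu.splittingConsistency hV hF.continuous_apply (hF.isTruncatedGroup R hR0) hF.norm_apply
    (hF.norm_trunc_le R hR0) (ContinuousLinearMap.norm_id_le.trans hκ) hκ (le_of_lt hh) hη.le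
    htube (happrox R hR) hosc

theorem exists_eventually_splittingConsistency_pullbackNorm [CompleteSpace X]
    (hF : IsSplittingFrame J U Q C) (hu : IsMildSolution U V T u) (hV : Continuous V)
    (hκ : 1 ≤ κ) (hJκ : ‖J‖ ≤ κ) (hδ : 0 < δ)
    (htube : IsLipschitzTube (pullbackNorm J) V (u '' Set.Icc 0 T) δ κ) :
    ∃ C₀, 0 ≤ C₀ ∧ ∀ᶠ h in 𝓝[>] (0 : ℝ), ∀ R, (h ^ 2)⁻¹ < R →
      SplittingConsistency (pullbackNorm J) U (Q R) V u T h δ κ (C₀ * h) := by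
  obtain ⟨b, hb0, hb⟩ :=
    (hu.isCompact_image.union (hu.isCompact_image.image hV)).isBounded.exists_pos_norm_le
  have hC := hF.nonneg
  set Capprox := C * (1 + κ) * b
  set Cosc := κ * ((C + ‖J‖) * b)
  have hCapprox : 0 ≤ Capprox := by positivity
  have hCosc : 0 ≤ Cosc := by positivity
  refine ⟨2 * (Capprox + Cosc), by positivity, ?_⟩
  filter_upwards [self_mem_nhdsWithin, mem_nhdsWithin_of_mem_nhds (Iic_mem_nhds one_pos),
    eventually_forall_norm_sub_le hu.continuousOn hδ] with h hh hh1 hcurve R hR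
  replace hh : 0 < h := hh
  have hR0 : 0 < R := lt_trans (by positivity) hR
  refine hu.splittingConsistency hV hF.continuous_apply (hF.isTruncatedGroup R hR0)
    hF.norm_map_apply (hF.norm_map_trunc_le R hR0) hJκ hκ hh.le (by positivity) htube
    (fun τ hτ x hx => ?_) (fun s hs t ht hst => ?_)
  · calc ‖J (U τ (Q R x) - x)‖ ≤ C * (1 + κ) * h * b :=
          (hF.norm_map_apply_trunc_sub_le hh hh1 hR hτ x).trans (by gcongr; exact hb x hx)
      _ = Capprox * h := by ring
      _ ≤ 2 * (Capprox + Cosc) * h / 2 := by linarith [mul_nonneg hCosc hh.le]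
  · calc ‖J (V (u s) - V (u t))‖ ≤ κ * ‖J (u s - u t)‖ :=
          htube.seminorm_sub_le _ ⟨t, ht, rfl⟩ _
            (mem_closedBall_iff_norm.2 (hcurve s hs t ht hst)) _ (Metric.mem_closedBall_self hδ.le)
      _ ≤ κ * ((C + ‖J‖) * b * h) := by
          gcongr
          exact (hF.norm_map_sub_le_of_isMildSolution hu hb hs ht).trans (by gcongr)
      _ = Cosc * h := by ring
      _ ≤ 2 * (Capprox + Cosc) * h / 2 := by linarith [mul_nonneg hCapprox hh.le]

end IsSplittingFrame

end Consistency

section Convergence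

variable {H X : Type*} [NormedAddCommGroup H] [InnerProductSpace ℂ H] [NormedAddCommGroup X]
  [InnerProductSpace ℂ X] {J : H →L[ℂ] X} {U : ℝ → H →L[ℂ] H} {B : H → H} {u : ℝ → H}
  {T h C δ κ : ℝ}

theorem mem_truncatedFlow (hJ : Function.Injective J) {P : X →L[ℂ] X} (t : ℝ) {x y : H}
    (hy : J y = P (J x)) : U t y ∈ truncatedFlow J P U t x := by
  have hex : ∃ y, J y = P (J x) := ⟨y, hy⟩
  have hmem : y ∈ restrictToSubspace J P x := ⟨hex, hJ (hex.choose_spec.trans hy.symm)⟩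
  exact Part.mem_map _ hmem

variable [CompleteSpace H]

theorem isSplittingPair_nonlinearFlow {Q : H →L[ℂ] H} {ΨA : ℝ → H → Part H}
    (hQ : IsTruncatedGroup U Q) (hΨA : ∀ s y, U s (Q y) ∈ ΨA s y)
    (htube : IsLipschitzTube (normSeminorm ℝ H) (fun x => -(Complex.I • B x))
      (u '' Set.Icc 0 T) δ κ) (hκ : 0 ≤ κ) (hh : κ ^ 2 * h < δ / 2) :
    IsSplittingPair U Q (fun x => -(Complex.I • B x)) u ΨA (nonlinearFlow B) T h δ κ where
  isTruncatedGroup := hQ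
  apply_trunc_mem := hΨA
  exists_mem_flow t ht w hw b hb := by
    lift κ to NNReal using hκ
    have hball : Metric.closedBall w (δ / 2) ⊆ Metric.closedBall (u t) δ :=
      Metric.closedBall_subset_closedBall' (by rw [dist_eq_norm]; linarith)
    have hL : LipschitzOnWith κ (fun x => -(Complex.I • B x)) (Metric.closedBall w (δ / 2)) :=
      LipschitzOnWith.of_dist_le_mul fun x hx y hy => by
        rw [dist_eq_norm, dist_eq_norm]
        exact htube.seminorm_sub_le _ ⟨t, ht, rfl⟩ x (hball hx) y (hball hy)
    have htime : |b| * κ < δ / 2 :=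
      (mul_le_mul_of_nonneg_right hb κ.coe_nonneg).trans_lt (by rwa [mul_right_comm, ← sq])
    simpa only [sq (κ : ℝ)] using exists_mem_nonlinearFlow hL
      (fun y hy => htube.seminorm_le _ ⟨t, ht, rfl⟩ y (hball hy)) htime

theorem IsSplittingFrame.exists_eventually_norm_map_sub_le [CompleteSpace X] {Q : ℝ → H →L[ℂ] H}
    (hF : IsSplittingFrame J U Q C) (hB : LocallyLipschitz B)
    (hBJ : LocallyLipschitzFor (pullbackNorm J) B)
    (hu : IsMildSolution U (fun x => -(Complex.I • B x)) T u) {m : ℕ} {a b : Fin m → ℝ}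
    (ha : ∑ j, a j = 1) (hb : ∑ j, b j = 1) :
    ∃ C₁ > (0 : ℝ), ∀ᶠ h in 𝓝[>] (0 : ℝ), ∀ R, (h ^ 2)⁻¹ < R → ∀ ΨA : ℝ → H → Part H,
      (∀ s y, U s (Q R y) ∈ ΨA s y) → ∀ k : ℕ, k * h ≤ T →
        ∃ v ∈ partialIterate (splittingStep ΨA (nonlinearFlow B) a b h) k (u 0),
          ‖J (u (k * h)) - J v‖ ≤ C₁ * h := by
  have hVc : Continuous fun x => -(Complex.I • B x) := (hB.continuous.const_smul _).neg
  have hBid : LocallyLipschitzFor (pullbackNorm (.id ℂ H)) B := locallyLipschitzFor_normSeminorm hB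
  obtain ⟨δ, hδ, htube, htubeJ⟩ := (eventually_mem_nhdsWithin.and
    ((eventually_isLipschitzTube hBid.neg_I_smul hVc hu.isCompact_image).and
      (eventually_isLipschitzTube hBJ.neg_I_smul hVc hu.isCompact_image))).exists
  obtain ⟨κ, htube, htubeJ, hκ, hJκ, haκ, hbκ⟩ := (htube.and (htubeJ.and
    ((eventually_ge_atTop 1).and ((eventually_ge_atTop ‖J‖).and
      ((eventually_ge_atTop (∑ j, |a j|)).and (eventually_ge_atTop (∑ j, |b j|))))))).exists
  obtain ⟨C₀, hC₀, hweak⟩ :=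
    hF.exists_eventually_splittingConsistency_pullbackNorm hu hVc hκ hJκ hδ htubeJ
  set W := Real.exp (3 * κ ^ 5 * ((m + 1) * T))
  set η₁ := δ / (16 * κ ^ 2 * W)
  have hδ0 : 0 < δ := hδ
  have hη₁ : 0 < η₁ := by positivity
  have hW : 0 < W := Real.exp_pos _
  have hη₁W : 2 * κ ^ 2 * (W * (4 * η₁)) = δ / 2 := by
    simp only [η₁]
    field_simp
    norm_num
  refine ⟨W * (2 * C₀ + 1), by positivity, ?_⟩
  filter_upwards [hweak, hF.eventually_splittingConsistency_normSeminorm hu hVc hκ htube hη₁,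
    self_mem_nhdsWithin, eventually_mul_lt_nhdsGT_zero 1 one_pos,
    eventually_mul_lt_nhdsGT_zero 1 hη₁, eventually_mul_lt_nhdsGT_zero (κ ^ 2) (half_pos hδ0)]
    with h hq h₁ hh hh1 hhη hflow R hR ΨA hΨA k hk
  have hR0 : 0 < R := (inv_nonneg.2 (sq_nonneg h)).trans_lt hR
  have hpair := isSplittingPair_nonlinearFlow (hF.isTruncatedGroup R hR0) hΨA htube
    (zero_le_one.trans hκ) hflow
  obtain ⟨v, hv, hle⟩ := hpair.exists_mem_partialIterate_seminorm_sub_le (h₁ R hR) (hq R hR) hκ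
    (le_of_lt hh) (by linarith) ha hb haκ hbκ
    ((by gcongr; linarith : _ ≤ 2 * κ ^ 2 * (W * (4 * η₁))).trans_eq hη₁W) k hk
  refine ⟨v, hv, ?_⟩
  rw [← map_sub]
  exact hle.trans_eq (by ring)

end Convergence

theorem mainTheorem4_general
    {H₁ H₀ : Type*}
    [NormedAddCommGroup H₁] [InnerProductSpace ℂ H₁] [CompleteSpace H₁]
    [NormedAddCommGroup H₀] [InnerProductSpace ℂ H₀] [CompleteSpace H₀]
    (ι : H₁ →L[ℂ] H₀) (hι : Function.Injective ι)
    (A : H₁ →ₗ.[ℂ] H₁) (hA : IsSelfAdjoint A)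
    (A₀ : H₀ →ₗ.[ℂ] H₀) (hA₀ : IsSelfAdjoint A₀)
    (hdom : ∀ x : H₁, ι x ∈ A₀.domain)
    (hext : ∀ x : A.domain, A₀ ⟨ι (x : H₁), hdom x⟩ = ι (A x))
    (ΦA : ℝ → H₁ →L[ℂ] H₁) (hΦA : IsUnitaryGroupGeneratedBy A ΦA)
    (E : ProjectionValuedMeasure H₀) (hE : IsSpectralMeasureOf A₀ E)
    (B : H₁ → H₁) (hB : LocallyLipschitz B)
    (hB₀ : LocallyLipschitzFor (pullbackNorm ι) B)
    {m : ℕ} (a b : Fin m → ℝ) (ha : ∑ j, a j = 1) (hb : ∑ j, b j = 1)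
    (u₀ : H₁) (T : ℝ) (hT : 0 < T) (hT' : (T : EReal) < maximalTime ΦA B u₀) :
    ∃ C > (0 : ℝ), ∃ n₀ : ℕ, 0 < n₀ ∧ ∀ n : ℕ, n₀ ≤ n → ∀ R : ℝ, ((T / n) ^ 2)⁻¹ < R →
      ∀ k : ℕ, k ≤ n →
        ∃ u ∈ exactFlow ΦA B (k * (T / n)) u₀,
        ∃ v ∈ partialIterate
            (splittingStep (truncatedFlow ι (E.proj (Set.Icc (-R) R)) ΦA) (nonlinearFlow B)
              a b (T / n)) k u₀,
          ‖ι u - ι v‖ ≤ C * (T / n) := by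
  have hgraph : ∀ x y, (x, y) ∈ A.graph → (ι x, ι y) ∈ A₀.graph := fun x y hxy => by
    obtain ⟨z, rfl, rfl⟩ := A.mem_graph_iff.1 hxy
    rw [← hext z]
    exact A₀.mem_graph ⟨ι z, hdom z⟩
  obtain ⟨Q, C₀, hF, hQE⟩ := exists_isSplittingFrame hι hA hA₀ hdom hgraph hΦA hE
  obtain ⟨u, hu⟩ := exists_isDuhamelSolution_of_lt_maximalTime hT'
  obtain rfl := hu.apply_zero hΦA hT.le
  obtain ⟨C, hC, hconv⟩ := hF.exists_eventually_norm_map_sub_le hB hB₀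
    (hu.isMildSolution hΦA hB.continuous) ha hb
  obtain ⟨n₀, hn₀, hstep⟩ := exists_forall_div_natCast hT hconv
  refine ⟨C, hC, n₀, hn₀, fun n hn R hR k hk => ?_⟩
  have hn' : (0 : ℝ) < n := Nat.cast_pos.2 (hn₀.trans_le hn)
  have hR0 : 0 < R := (inv_nonneg.2 (sq_nonneg _)).trans_lt hR
  have hkT : k * (T / n) ≤ T := by
    rw [mul_div_assoc', div_le_iff₀ hn', mul_comm T]
    gcongr
  obtain ⟨v, hv, herr⟩ := hstep n hn R hR _ (fun t x => mem_truncatedFlow hι t (hQE R hR0 x)) k hkT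
  exact ⟨_, hu.mem_exactFlow hΦA hB ⟨by positivity, hkT⟩, v, hv, herr⟩

theorem mainTheorem4
    -- the Hilbert spaces `H₁ ⊆ H₀`, with continuous embedding `ι`
    {H₁ H₀ : Type*}
    [NormedAddCommGroup H₁] [InnerProductSpace ℂ H₁] [CompleteSpace H₁]
    [NormedAddCommGroup H₀] [InnerProductSpace ℂ H₀] [CompleteSpace H₀]
    (ι : H₁ →L[ℂ] H₀) (hι : Function.Injective ι)
    -- the self-adjoint operator `A` in `H₁`, its self-adjoint extension `A₀` in `H₀`
    (A : H₁ →ₗ.[ℂ] H₁) (hA : IsSelfAdjoint A)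
    (A₀ : H₀ →ₗ.[ℂ] H₀) (hA₀ : IsSelfAdjoint A₀)
    (hdom : ∀ x : H₁, ι x ∈ A₀.domain)
    (hext : ∀ x : A.domain, A₀ ⟨ι (x : H₁), hdom x⟩ = ι (A x))
    -- the unitary group generated by `-iA` and the spectral measure of `A₀`
    (ΦA : ℝ → H₁ →L[ℂ] H₁) (hΦA : IsUnitaryGroupGeneratedBy A ΦA)
    (E : ProjectionValuedMeasure H₀) (hE : IsSpectralMeasureOf A₀ E)
    -- the nonlinearity
    (B : H₁ → H₁) (hB : LocallyLipschitz B)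
    (B' : H₁ → H₀ →L[ℝ] H₀)
    (hB' : ∀ r > (0 : ℝ), ∀ ε > (0 : ℝ), ∃ C > (0 : ℝ), ∃ δ > (0 : ℝ),
      ∀ u w : H₁, ‖u‖ ≤ r → ‖w‖ < δ →
        ‖B' u‖ ≤ C ∧ ‖ι (B (u + w)) - ι (B u) - B' u (ι w)‖ ≤ ε * ‖ι w‖)
    -- the splitting coefficients
    {m : ℕ} (a b : Fin m → ℝ) (ha : ∑ j, a j = 1) (hb : ∑ j, b j = 1)
    -- the initial datum and the final time
    (u₀ : H₁) (T : ℝ) (hT : 0 < T) (hT' : (T : EReal) < maximalTime ΦA B u₀) :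
    ∃ C > (0 : ℝ), ∃ n₀ : ℕ, 0 < n₀ ∧ ∀ n : ℕ, n₀ ≤ n → ∀ R : ℝ, ((T / n) ^ 2)⁻¹ < R →
      ∀ k : ℕ, k ≤ n →
        ∃ u ∈ exactFlow ΦA B (k * (T / n)) u₀,
        ∃ v ∈ partialIterate
            (splittingStep (truncatedFlow ι (E.proj (Set.Icc (-R) R)) ΦA) (nonlinearFlow B)
              a b (T / n)) k u₀,
          ‖ι u - ι v‖ ≤ C * (T / n) :=
  mainTheorem4_general ι hι A hA A₀ hA₀ hdom hext ΦA hΦA E hE B hB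
    (locallyLipschitzFor_of_norm_sub_sub_le fun r hr =>
      let ⟨C, _, δ, hδ, h⟩ := hB' r hr 1 one_pos
      ⟨1, C, δ, hδ, h⟩)
    a b ha hb u₀ T hT hT'
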